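/- Let $n$ be a positive integer and let $\xi$ be a real number. The height $H(P)$ of an integer polynomial $P$ is the maximum of the moduli of its coefficients, and the height $H(\alpha)$ of an algebraic number $\alpha$ is the height of its minimal polynomial over $\mathbb{Z}$. Let $\lambda_n(\xi)\in\mathbb{R}\cup\{\pm\infty\}$ be the supremum of the real numbers $\lambda$ such that $\max_{1\le j\le n}|x_0\xi^j-x_j|\le |x_0|^{-\lambda}$ has infinitely many solutions in integers $x_0,\dots,x_n$ with $x_0\ne 0$. Let $\hat w_n(\xi)$ be the supremum of the real numbers $\hat w$ such that, for every sufficiently large real number $X$, the inequalities $0<|x_n\xi^n+\dots+x_1\xi+x_0|\le X^{-\hat w}$, $\max_{0\le j\le n}|x_j|\le X$ have a solution in integers $x_0,\dots,x_n$. Let $\hat w_n^*(\xi)$ be the supremum of the real numbers $\hat w^*$ such that, for every sufficiently large real number $X$, there exists a real algebraic number $\alpha$ of degree at most $n$ with $0<|\xi-\alpha|\le H(\alpha)^{-1}X^{-\hat w^*}$ and $H(\alpha)\le X$. The spectrum of an exponent of approximation is the set of values that it takes at transcendental real numbers. Theorem 5.6. For every positive integer $n$, the spectrum of $\lambda_n$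 includes the interval $[1,+\infty]$, the spectrum of $\hat w_n^*$ includes the interval $[1,2-1/n]$, and the spectrum of $\hat w_n-\hat w_n^*$ includes the interval $[n-2+1/n,\,n-1]$. -/

import Mathlib

open Filter

namespace DiophantineExponent

noncomputable section

/-- The height `H(P)` of an integer polynomial: the maximum of the moduli of its coefficients. -/
def polyHeight (P : Polynomial ℤ) : ℕ :=
  P.support.sup fun i => (P.coeff i).natAbs

/-- The minimal polynomial of an algebraic number over `ℤ` (unique up to sign): the primitive
integer polynomial proportional to its monic minimal polynomial over `ℚ`. -/
def intMinpoly (α : ℝ) : Polynomial ℤ :=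
  (IsLocalization.integerNormalization (nonZeroDivisors ℤ) (minpoly ℚ α)).primPart

/-- The height `H(α)` of a real algebraic number `α`: the height of its minimal polynomial
over `ℤ`. -/
def algHeight (α : ℝ) : ℕ :=
  polyHeight (intMinpoly α)

/-- `λ_n(ξ)`: the supremum of the real `l` such that `max_{1 ≤ j ≤ n} |x₀ ξ^j - x_j| ≤ |x₀|^{-l}`
has infinitely many solutions in integers `x₀, …, x_n` with `x₀ ≠ 0`. -/
def lambda (n : ℕ) (ξ : ℝ) : EReal :=
  sSup ((fun l : ℝ => (l : EReal)) ''
    {l : ℝ | {x : Fin (n + 1) → ℤ | x 0 ≠ 0 ∧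
      ∀ j : Fin (n + 1), 1 ≤ (j : ℕ) →
        |(x 0 : ℝ) * ξ ^ (j : ℕ) - (x j : ℝ)| ≤ |(x 0 : ℝ)| ^ (-l)}.Infinite})

/-- `ŵ_n(ξ)`: the supremum of the real `w` such that, for every sufficiently large real `X`,
`0 < |x_n ξ^n + ⋯ + x₁ ξ + x₀| ≤ X^{-w}`, `max |x_j| ≤ X` has a solution in integers. -/
def wHat (n : ℕ) (ξ : ℝ) : EReal :=
  sSup ((fun w : ℝ => (w : EReal)) ''
    {w : ℝ | ∀ᶠ X : ℝ in atTop, ∃ x : Fin (n + 1) → ℤ,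
      0 < |∑ j : Fin (n + 1), (x j : ℝ) * ξ ^ (j : ℕ)| ∧
      |∑ j : Fin (n + 1), (x j : ℝ) * ξ ^ (j : ℕ)| ≤ X ^ (-w) ∧
      ∀ j : Fin (n + 1), |(x j : ℝ)| ≤ X})

/-- `ŵ*_n(ξ)`: the supremum of the real `w` such that, for every sufficiently large real `X`,
there is a real algebraic number `α` of degree at most `n` with
`0 < |ξ - α| ≤ H(α)⁻¹ X^{-w}` and `H(α) ≤ X`. -/
def wHatStar (n : ℕ) (ξ : ℝ) : EReal :=
  sSup ((fun w : ℝ => (w : EReal)) ''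
    {w : ℝ | ∀ᶠ X : ℝ in atTop, ∃ α : ℝ,
      IsAlgebraic ℚ α ∧ (minpoly ℚ α).natDegree ≤ n ∧
      0 < |ξ - α| ∧ |ξ - α| ≤ (algHeight α : ℝ)⁻¹ * X ^ (-w) ∧
      (algHeight α : ℝ) ≤ X})

/-- The spectrum of an exponent of approximation: the set of values that it takes at
transcendental real numbers. -/
def exponentSpectrum (f : ℝ → EReal) : Set EReal :=
  f '' {ξ : ℝ | Transcendental ℚ ξ}

end

end DiophantineExponent

namespace DiophantineExponent

open Polynomial

/-! One family of numbers gives all three spectra. For `W ≥ 2n - 1`, take `ξ` transcendental with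
reduced fractions `p_k/q_k` such that `q_{k+1} ≍ q_k^W` and `ξ - p_k/q_k ≍ 1/(q_k q_{k+1})`. Then
`λ_n(ξ) = (W - n + 1)/n`, `ŵ_n(ξ) = n` and `ŵ*_n(ξ) = W/(W - n + 1)`. As `W` runs through `[2n - 1,
∞)`, the first value runs through `[1, ∞)`. For `n ≥ 2`, the third runs through `(1, 2 - 1/n]`. The
endpoints `+∞` and `1` come from growth exponents that tend to infinity with `k`; for `n = 1` the
second interval is the point `1`.

The main tool is `RapidApprox.inv_le_abs_aeval`: an integer polynomial that does not vanish at
`p_k/q_k` has value at least `q_k^{-n}` there, and this survives up to a factor 2 at `ξ` while its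
height is `≪ q_{k+1}/q_k^{n-1}`. It bounds `ŵ_n` and `ŵ*_n` from above at well-chosen `X`. Together
with splitting off factors `q_k X - p_k`, it yields `|P(ξ)| ≫ H(P)^{-W}`
(`RapidApprox.rpow_neg_le_abs_aeval`).

The lower bound for `λ_n` uses the points `(q_k^n, q_k^{n-1} p_k, …, p_k^n)`. Its upper bound holds
because approximations with exponent above 1 must be multiples of such points for some fraction. The
lower bounds for `ŵ_n` and `ŵ*_n` come from a box principle (`exists_small_value`). For `ŵ*_n`, the
bound `|P(ξ)| ≫ H(P)^{-W}` forces the polynomial found to have a derivative at `ξ` comparable to its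
height, hence a root very close to `ξ`. -/

/-! ### Heights, Taylor estimates and roots near a point -/

theorem abs_coeff_le_polyHeight (P : ℤ[X]) (i : ℕ) : |(P.coeff i : ℝ)| ≤ polyHeight P := by
  have h : (P.coeff i).natAbs ≤ polyHeight P := by
    by_cases hi : i ∈ P.support
    · exact Finset.le_sup (f := fun i => (P.coeff i).natAbs) hi
    · simp [notMem_support_iff.mp hi]
  rw [← Int.cast_abs, Int.abs_eq_natAbs]
  exact_mod_cast h

theorem polyHeight_le {P : ℤ[X]} {N : ℝ} (hN : 0 ≤ N) (h : ∀ i, |(P.coeff i : ℝ)| ≤ N) :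
    (polyHeight P : ℝ) ≤ N := by
  have h1 : polyHeight P ≤ ⌊N⌋₊ := by
    refine Finset.sup_le fun i _ => Nat.le_floor ?_
    have := h i
    rwa [← Int.cast_abs, Int.abs_eq_natAbs, Int.cast_natCast] at this
  exact (Nat.cast_le.mpr h1).trans (Nat.floor_le hN)

theorem one_le_polyHeight {P : ℤ[X]} (hP : P ≠ 0) : (1 : ℝ) ≤ polyHeight P := by
  refine le_trans ?_ (abs_coeff_le_polyHeight P P.natDegree)
  exact_mod_cast Int.one_le_abs (leadingCoeff_ne_zero.mpr hP)

theorem aeval_eq_sum_range_succ {P : ℤ[X]} {n : ℕ} (hn : P.natDegree ≤ n) (x : ℝ) :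
    aeval x P = ∑ i ∈ Finset.range (n + 1), (P.coeff i : ℝ) * x ^ i := by
  rw [aeval_eq_sum_range' (Nat.lt_succ_of_le hn)]
  simp [zsmul_eq_mul]

theorem aeval_derivative_eq_sum {P : ℤ[X]} {n : ℕ} (hn : P.natDegree ≤ n) (x : ℝ) :
    aeval x (derivative P) =
      ∑ i ∈ Finset.range (n + 1), (P.coeff i : ℝ) * (i * x ^ (i - 1)) := by
  conv_lhs => rw [P.as_sum_range' (n + 1) (Nat.lt_succ_of_le hn)]
  simp only [derivative_monomial, map_sum]
  refine Finset.sum_congr rfl fun i _ => ?_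
  simp [aeval_monomial, mul_assoc]

/-- A common constant for first and second order estimates of a polynomial of degree at most `n`
in terms of its height. -/
noncomputable def taylorConst (n : ℕ) : ℝ := (n + 1) * 4 ^ n

theorem one_le_taylorConst (n : ℕ) : 1 ≤ taylorConst n := by
  unfold taylorConst
  have h1 : (1 : ℝ) ≤ (4 : ℝ) ^ n := one_le_pow₀ (by norm_num)
  have h2 : (0 : ℝ) ≤ n := n.cast_nonneg
  nlinarith

theorem abs_sum_coeff_mul_le {P : ℤ[X]} {n : ℕ} {f : ℕ → ℝ} {c : ℝ} (hc : 0 ≤ c)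
    (h : ∀ i, |f i| ≤ 4 ^ i * c) :
    |∑ i ∈ Finset.range (n + 1), (P.coeff i : ℝ) * f i| ≤ taylorConst n * polyHeight P * c := by
  calc _ ≤ ∑ i ∈ Finset.range (n + 1), |(P.coeff i : ℝ) * f i| := Finset.abs_sum_le_sum_abs _ _
    _ ≤ ∑ i ∈ Finset.range (n + 1), (polyHeight P : ℝ) * (4 ^ n * c) := by
        refine Finset.sum_le_sum fun i hi => ?_
        rw [abs_mul]
        refine mul_le_mul (abs_coeff_le_polyHeight P i) ((h i).trans ?_) (abs_nonneg _)
          (Nat.cast_nonneg _)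
        refine mul_le_mul_of_nonneg_right ?_ hc
        exact pow_le_pow_right₀ (by norm_num) (by simpa [Nat.lt_succ_iff] using hi)
    _ = _ := by simp [taylorConst]; ring

theorem abs_pow_sub_pow_le {x y : ℝ} (hx : |x| ≤ 2) (hy : |y| ≤ 2) (j : ℕ) :
    |x ^ j - y ^ j| ≤ 4 ^ j * |x - y| := by
  induction j with
  | zero => simp
  | succ j ih =>
    have h1 : x ^ (j + 1) - y ^ (j + 1) = x * (x ^ j - y ^ j) + y ^ j * (x - y) := by ring
    have h2 : |y ^ j| ≤ 4 ^ j := by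
      rw [abs_pow]
      exact pow_le_pow_left₀ (abs_nonneg _) (by linarith) j
    calc _ ≤ |x| * |x ^ j - y ^ j| + |y ^ j| * |x - y| := by
          rw [h1, ← abs_mul, ← abs_mul]; exact abs_add_le _ _
      _ ≤ 2 * (4 ^ j * |x - y|) + 4 ^ j * |x - y| := by gcongr
      _ ≤ _ := by rw [pow_succ]; nlinarith [mul_nonneg (pow_nonneg (by norm_num : (0:ℝ) ≤ 4) j)
                    (abs_nonneg (x - y))]

theorem abs_aeval_sub_aeval_le {P : ℤ[X]} {n : ℕ} (hn : P.natDegree ≤ n) {x y : ℝ}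
    (hx : |x| ≤ 2) (hy : |y| ≤ 2) :
    |aeval x P - aeval y P| ≤ taylorConst n * polyHeight P * |x - y| := by
  rw [aeval_eq_sum_range_succ hn, aeval_eq_sum_range_succ hn, ← Finset.sum_sub_distrib]
  simp_rw [← mul_sub]
  exact abs_sum_coeff_mul_le (abs_nonneg _) fun i => abs_pow_sub_pow_le hx hy i

theorem abs_add_pow_sub_le {x t : ℝ} (hx : |x| ≤ 1) (ht : |t| ≤ 1) (j : ℕ) :
    |(x + t) ^ j - x ^ j - t * (j * x ^ (j - 1))| ≤ 4 ^ j * t ^ 2 := by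
  induction j with
  | zero => simp; positivity
  | succ j ih =>
    have h1 : (x + t) ^ (j + 1) - x ^ (j + 1) - t * ((j + 1 : ℕ) * x ^ (j + 1 - 1)) =
        (x + t) * ((x + t) ^ j - x ^ j - t * (j * x ^ (j - 1))) + j * x ^ (j - 1) * t ^ 2 := by
      rcases j with _ | j
      · simp
      · simp only [Nat.add_sub_cancel, Nat.cast_add, Nat.cast_one]; ring
    have h2 : |x + t| ≤ 2 := (abs_add_le _ _).trans (by linarith)
    have h3 : |(j : ℝ) * x ^ (j - 1)| ≤ 2 * 4 ^ j := by
      rw [abs_mul, abs_pow, Nat.abs_cast]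
      have h4 : (j : ℝ) ≤ 2 * 4 ^ j := by
        have : j < 4 ^ j := Nat.lt_pow_self (by norm_num)
        have : (j : ℝ) ≤ (4 : ℝ) ^ j := by exact_mod_cast this.le
        have : (0 : ℝ) ≤ (4 : ℝ) ^ j := by positivity
        linarith
      calc _ ≤ (j : ℝ) * 1 := by gcongr; exact pow_le_one₀ (abs_nonneg _) hx
        _ ≤ _ := by linarith
    calc _ ≤ |x + t| * |(x + t) ^ j - x ^ j - t * (j * x ^ (j - 1))| +
            |(j : ℝ) * x ^ (j - 1)| * t ^ 2 := by
          rw [h1]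
          refine (abs_add_le _ _).trans ?_
          rw [abs_mul, abs_mul _ (t ^ 2), abs_of_nonneg (sq_nonneg t)]
      _ ≤ 2 * (4 ^ j * t ^ 2) + 2 * 4 ^ j * t ^ 2 := by gcongr
      _ = _ := by ring

theorem abs_aeval_add_sub_le {P : ℤ[X]} {n : ℕ} (hn : P.natDegree ≤ n) {x t : ℝ}
    (hx : |x| ≤ 1) (ht : |t| ≤ 1) :
    |aeval (x + t) P - aeval x P - t * aeval x (derivative P)| ≤
      taylorConst n * polyHeight P * t ^ 2 := by
  rw [aeval_eq_sum_range_succ hn, aeval_eq_sum_range_succ hn, aeval_derivative_eq_sum hn,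
    Finset.mul_sum, ← Finset.sum_sub_distrib, ← Finset.sum_sub_distrib]
  have : ∀ i, (P.coeff i : ℝ) * (x + t) ^ i - P.coeff i * x ^ i -
      t * (P.coeff i * (i * x ^ (i - 1))) =
      P.coeff i * ((x + t) ^ i - x ^ i - t * (i * x ^ (i - 1))) := fun i => by ring
  simp_rw [this]
  exact abs_sum_coeff_mul_le (sq_nonneg _) fun i => abs_add_pow_sub_le hx ht i

/-- A polynomial with a small value and a large derivative at `x` has a real root near `x`. -/
theorem exists_root_near {P : ℤ[X]} {n : ℕ} (hn : P.natDegree ≤ n) (hP : P ≠ 0) {x : ℝ}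
    (hx : |x| ≤ 1) (hd : (polyHeight P : ℝ) ≤ 2 * |aeval x (derivative P)|)
    (hs : 16 * taylorConst n * |aeval x P| ≤ 1) :
    ∃ α : ℝ, aeval α P = 0 ∧ |x - α| ≤ 4 * |aeval x P| / polyHeight P := by
  set D := aeval x (derivative P) with hD
  set v := aeval x P with hv
  set H : ℝ := (polyHeight P : ℝ) with hH
  have hH1 : 1 ≤ H := one_le_polyHeight hP
  have hK := one_le_taylorConst n
  set K := taylorConst n
  have hDpos : 0 < |D| := by linarith
  have hD0 : D ≠ 0 := abs_pos.mp hDpos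
  -- Twice the Newton step: up to an error at most `|v|`, the values at `x + s` and `x - s` are `v +
  -- 2|v| ≥ |v|` and `v - 2|v| ≤ -|v|`, so the sign changes between them.
  set s := 2 * |v| / D with hsdef
  have hsD : s * D = 2 * |v| := by rw [hsdef]; field_simp
  have habs : |s| * |D| = 2 * |v| := by
    rw [← abs_mul, hsD, abs_of_nonneg (by positivity)]
  have hsle : |s| ≤ 4 * |v| / H := by
    rw [le_div_iff₀ (by linarith)]
    nlinarith [abs_nonneg s]
  have hv1 : 16 * |v| ≤ 1 := by nlinarith [abs_nonneg v]
  have hsle1 : |s| ≤ 1 := by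
    refine hsle.trans ?_
    rw [div_le_one (by linarith)]
    linarith [abs_nonneg v]
  have herr : K * H * s ^ 2 ≤ |v| := by
    have h1 : |s| * H ≤ 4 * |v| := by rwa [le_div_iff₀ (by linarith)] at hsle
    have h2 : |s| ≤ 4 * |v| := by nlinarith [abs_nonneg s]
    rw [← sq_abs]
    have h3 : |s| * H * |s| ≤ 4 * |v| * (4 * |v|) := by gcongr
    have h4 : K * (|s| * H * |s|) ≤ K * (4 * |v| * (4 * |v|)) := by gcongr
    have h5 : 16 * K * |v| * |v| ≤ 1 * |v| := by gcongr
    nlinarith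
  have e1 := (abs_le.mp ((abs_aeval_add_sub_le hn hx hsle1).trans herr)).1
  have herr' : K * H * (-s) ^ 2 ≤ |v| := by rwa [neg_sq]
  have hsle' : |-s| ≤ 1 := by rwa [abs_neg]
  have e2 := (abs_le.mp ((abs_aeval_add_sub_le hn hx hsle').trans herr')).2
  rw [← hD, ← hv] at e1 e2
  have g1 : 0 ≤ aeval (x + s) P := by linarith [neg_abs_le v]
  have g2 : aeval (x + -s) P ≤ 0 := by linarith [le_abs_self v]
  have hcont : ContinuousOn (fun y : ℝ => aeval y P) (Set.uIcc (x + -s) (x + s)) :=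
    (Polynomial.continuous_aeval P).continuousOn
  obtain ⟨α, hα, hα0⟩ := intermediate_value_uIcc hcont
    (Set.mem_uIcc.mpr (Or.inl ⟨g2, g1⟩) : (0 : ℝ) ∈ _)
  refine ⟨α, hα0, le_trans ?_ hsle⟩
  rcases Set.mem_uIcc.mp hα with ⟨h1, h2⟩ | ⟨h1, h2⟩
  · exact abs_le.mpr ⟨by linarith [le_abs_self s], by linarith [le_abs_self s]⟩
  · exact abs_le.mpr ⟨by linarith [neg_abs_le s], by linarith [neg_abs_le s]⟩

/-! ### Heights of divisors and integer minimal polynomials -/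

/-- A constant for the comparison of the height of a polynomial of degree at most `n` with that of
its divisors. -/
noncomputable def divisorConst (n : ℕ) : ℝ := 2 ^ n * (n + 1)

theorem one_le_divisorConst (n : ℕ) : 1 ≤ divisorConst n := by
  unfold divisorConst
  have h1 : (1 : ℝ) ≤ (2 : ℝ) ^ n := one_le_pow₀ (by norm_num)
  have h2 : (0 : ℝ) ≤ n := n.cast_nonneg
  nlinarith

/-- The Mahler measure is multiplicative and at least 1 on nonzero integer polynomials, so that of
`Q` is at most that of `P`. It is compared with heights by the sum of the coefficients on one side
and by binomial coefficients on the other. -/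
theorem polyHeight_le_of_dvd {P Q : ℤ[X]} {n : ℕ} (hn : P.natDegree ≤ n) (hP : P ≠ 0)
    (h : Q ∣ P) : (polyHeight Q : ℝ) ≤ divisorConst n * polyHeight P := by
  obtain ⟨R, rfl⟩ := h
  have hQ : Q ≠ 0 := left_ne_zero_of_mul hP
  have hR : R ≠ 0 := right_ne_zero_of_mul hP
  have hQn : Q.natDegree ≤ n := (natDegree_le_of_dvd (dvd_mul_right Q R) hP).trans hn
  have hiso : Isometry (Int.castRingHom ℂ) :=
    Isometry.of_dist_eq fun a b => by simp [dist_eq_norm, ← Int.cast_sub, Int.norm_eq_abs]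
  have hM : (Q * R).mapMahlerMeasure (Int.castRingHom ℂ) ≤ (n + 1) * polyHeight (Q * R) := by
    refine (mapMahlerMeasure_le_sum_norm_coeff _ _ hiso).trans ?_
    rw [sum_over_range' _ (by simp) (n + 1) (Nat.lt_succ_of_le hn)]
    refine (Finset.sum_le_sum fun i _ => (?_ : _ ≤ (polyHeight (Q * R) : ℝ))).trans (by simp)
    rw [Int.norm_eq_abs]
    exact abs_coeff_le_polyHeight _ _
  refine polyHeight_le (mul_nonneg (zero_le_one.trans (one_le_divisorConst n))
    (Nat.cast_nonneg _)) fun i => ?_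
  have h1 := norm_coeff_le_choose_mul_mapMahlerMeasure _ hiso i Q
  rw [Int.norm_eq_abs] at h1
  have h2 : ((Q.natDegree.choose i : ℕ) : ℝ) ≤ 2 ^ n := by
    exact_mod_cast (Nat.choose_le_two_pow _ _).trans (Nat.pow_le_pow_right (by norm_num) hQn)
  have h3 : Q.mapMahlerMeasure (Int.castRingHom ℂ) ≤
      (Q * R).mapMahlerMeasure (Int.castRingHom ℂ) := by
    rw [mapMahlerMeasure_mul]
    exact le_mul_of_one_le_right (mapMahlerMeasure_nonneg _ _) (one_le_mahlerMeasure_of_ne_zero hR)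
  calc _ ≤ _ := h1
    _ ≤ 2 ^ n * ((n + 1) * polyHeight (Q * R)) := by
        gcongr
        · exact mapMahlerMeasure_nonneg _ _
        · exact h3.trans hM
    _ = _ := by rw [divisorConst]; ring

/-- Clearing denominators and removing the content only multiply by nonzero rationals. With
primitivity, this lets Gauss's lemma transfer divisibility from `ℚ[X]` to `ℤ[X]`. -/
theorem exists_map_intMinpoly {α : ℝ} (hα : IsAlgebraic ℚ α) :
    ∃ c : ℚ, c ≠ 0 ∧ (intMinpoly α).map (Int.castRingHom ℚ) = C c * minpoly ℚ α := by
  have hm : minpoly ℚ α ≠ 0 := minpoly.ne_zero hα.isIntegral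
  set N := IsLocalization.integerNormalization (nonZeroDivisors ℤ) (minpoly ℚ α) with hN
  have hN0 : N ≠ 0 := fun h => hm (IsFractionRing.integerNormalization_eq_zero_iff.mp h)
  obtain ⟨b, hbM, hb⟩ := IsLocalization.integerNormalization_spec (nonZeroDivisors ℤ)
    (minpoly ℚ α)
  have hb0 : (b : ℚ) ≠ 0 := by exact_mod_cast nonZeroDivisors.ne_zero hbM
  have hc0 : ((N.content : ℤ) : ℚ) ≠ 0 := by
    exact_mod_cast (mt content_eq_zero_iff.mp hN0)
  have h1 : C ((N.content : ℤ) : ℚ) * (intMinpoly α).map (Int.castRingHom ℚ) =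
      C (b : ℚ) * minpoly ℚ α := by
    have h2 := congrArg (Polynomial.map (Int.castRingHom ℚ)) N.eq_C_content_mul_primPart
    rw [Polynomial.map_mul, map_C] at h2
    have h3 : N.map (Int.castRingHom ℚ) = C (b : ℚ) * minpoly ℚ α := by
      rw [← smul_eq_C_mul, Int.cast_smul_eq_zsmul]
      exact hb
    rw [← h3, h2]
    rfl
  refine ⟨(N.content : ℚ)⁻¹ * b, mul_ne_zero (inv_ne_zero hc0) hb0, ?_⟩
  rw [C_mul, mul_assoc, ← h1, ← mul_assoc, ← C_mul, inv_mul_cancel₀ hc0, C_1, one_mul]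

theorem isPrimitive_intMinpoly (α : ℝ) : (intMinpoly α).IsPrimitive := isPrimitive_primPart _

theorem intMinpoly_ne_zero (α : ℝ) : intMinpoly α ≠ 0 := (isPrimitive_intMinpoly α).ne_zero

theorem aeval_map_castRingHom_rat (P : ℤ[X]) (x : ℝ) :
    aeval x (P.map (Int.castRingHom ℚ)) = aeval x P :=
  aeval_map_algebraMap ℚ x P

theorem aeval_intMinpoly {α : ℝ} (hα : IsAlgebraic ℚ α) : aeval α (intMinpoly α) = 0 := by
  obtain ⟨c, -, h⟩ := exists_map_intMinpoly hα
  rw [← aeval_map_castRingHom_rat, h, map_mul, minpoly.aeval, mul_zero]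

theorem natDegree_intMinpoly {α : ℝ} (hα : IsAlgebraic ℚ α) :
    (intMinpoly α).natDegree = (minpoly ℚ α).natDegree := by
  obtain ⟨c, hc, h⟩ := exists_map_intMinpoly hα
  rw [← natDegree_map_eq_of_injective (f := Int.castRingHom ℚ) Int.cast_injective, h,
    natDegree_C_mul hc]

theorem intMinpoly_dvd {α : ℝ} (hα : IsAlgebraic ℚ α) {P : ℤ[X]} (hP : aeval α P = 0) :
    intMinpoly α ∣ P := by
  obtain ⟨c, hc, h⟩ := exists_map_intMinpoly hα
  rw [IsPrimitive.Int.dvd_iff_map_cast_dvd_map_cast _ _ (isPrimitive_intMinpoly α), h,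
    (isUnit_C.mpr hc.isUnit).mul_left_dvd]
  exact minpoly.dvd ℚ α (by rwa [aeval_map_castRingHom_rat])

theorem eq_of_aeval_intMinpoly {α : ℝ} (hα : IsAlgebraic ℚ α) {r : ℚ}
    (h : aeval (r : ℝ) (intMinpoly α) = 0) : α = r := by
  obtain ⟨c, hc, hm⟩ := exists_map_intMinpoly hα
  rw [← aeval_map_castRingHom_rat, hm, map_mul, aeval_C, mul_eq_zero] at h
  rcases h with h | h
  · exact absurd h (by simpa using hc)
  · have h2 : (minpoly ℚ α).IsRoot r := by
      have : aeval (algebraMap ℚ ℝ r) (minpoly ℚ α) = 0 := h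
      rw [aeval_algebraMap_apply] at this
      simpa [IsRoot] using this
    exact (minpoly.root hα.isIntegral h2).symm

theorem one_le_algHeight (α : ℝ) : (1 : ℝ) ≤ algHeight α := one_le_polyHeight (intMinpoly_ne_zero α)

theorem isAlgebraic_of_aeval_int {α : ℝ} {P : ℤ[X]} (hP0 : P ≠ 0) (hP : aeval α P = 0) :
    IsAlgebraic ℚ α :=
  ⟨P.map (Int.castRingHom ℚ), (Polynomial.map_ne_zero_iff Int.cast_injective).mpr hP0,
    by rwa [aeval_map_castRingHom_rat]⟩

theorem natDegree_minpoly_le {α : ℝ} {P : ℤ[X]} (hP0 : P ≠ 0) (hP : aeval α P = 0) :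
    (minpoly ℚ α).natDegree ≤ P.natDegree := by
  rw [← natDegree_intMinpoly (isAlgebraic_of_aeval_int hP0 hP)]
  exact natDegree_le_of_dvd (intMinpoly_dvd (isAlgebraic_of_aeval_int hP0 hP) hP) hP0

theorem algHeight_le {α : ℝ} {P : ℤ[X]} {n : ℕ} (hP0 : P ≠ 0) (hn : P.natDegree ≤ n)
    (hP : aeval α P = 0) : (algHeight α : ℝ) ≤ divisorConst n * polyHeight P :=
  polyHeight_le_of_dvd hn hP0 (intMinpoly_dvd (isAlgebraic_of_aeval_int hP0 hP) hP)

theorem aeval_ne_zero_of_transcendental {ξ : ℝ} (hξ : Transcendental ℚ ξ) {P : ℤ[X]}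
    (hP : P ≠ 0) : aeval ξ P ≠ 0 := fun h => hξ (isAlgebraic_of_aeval_int hP h)

/-! ### Linear factors and values at rational points -/

/-- The linear polynomial `q X - p`. -/
noncomputable def linPoly (p q : ℤ) : ℤ[X] := C q * X - C p

theorem aeval_linPoly (p q : ℤ) (x : ℝ) : aeval x (linPoly p q) = q * x - p := by
  simp [linPoly]

theorem coeff_linPoly (p q : ℤ) (i : ℕ) :
    (linPoly p q).coeff i = if i = 0 then -p else if i = 1 then q else 0 := by
  rcases i with _ | _ | i <;> simp [-eq_intCast, linPoly, coeff_X, coeff_C]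

theorem linPoly_ne_zero {p q : ℤ} (hq : q ≠ 0) : linPoly p q ≠ 0 := fun h => hq <| by
  simpa [coeff_linPoly] using congrArg (fun P => P.coeff 1) h

theorem natDegree_linPoly {p q : ℤ} (hq : q ≠ 0) : (linPoly p q).natDegree = 1 := by
  rw [linPoly, natDegree_sub_C, natDegree_C_mul hq, natDegree_X]

theorem polyHeight_linPoly_le {p q : ℤ} {N : ℝ} (hp : |(p : ℝ)| ≤ N) (hq : |(q : ℝ)| ≤ N) :
    (polyHeight (linPoly p q) : ℝ) ≤ N := by
  have hN : 0 ≤ N := (abs_nonneg _).trans hp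
  refine polyHeight_le hN fun i => ?_
  rw [coeff_linPoly]
  split_ifs <;> simp [hp, hq, hN]

theorem isPrimitive_linPoly {p q : ℤ} (h : IsCoprime p q) : (linPoly p q).IsPrimitive := by
  intro r hr
  rw [C_dvd_iff_dvd_coeff] at hr
  have h0 := hr 0
  have h1 := hr 1
  simp only [coeff_linPoly, if_true, one_ne_zero, if_false, dvd_neg] at h0 h1
  exact h.isUnit_of_dvd' h0 h1

/-- Splitting off the linear factor corresponding to a rational root. -/
theorem exists_eq_linPoly_mul {p q : ℤ} (hpq : IsCoprime p q) (hq : 0 < q) {P : ℤ[X]}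
    (h : aeval ((p : ℝ) / q) P = 0) : ∃ R, P = linPoly p q * R := by
  have hqQ : (q : ℚ) ≠ 0 := by exact_mod_cast hq.ne'
  have h1 : linPoly p q ∣ P := by
    rw [IsPrimitive.Int.dvd_iff_map_cast_dvd_map_cast _ _ (isPrimitive_linPoly hpq)]
    have h2 : (linPoly p q).map (Int.castRingHom ℚ) = C (q : ℚ) * (X - C ((p : ℚ) / q)) := by
      rw [mul_sub, ← C_mul, mul_div_cancel₀ _ hqQ]
      simp [linPoly]
    rw [h2, (isUnit_C.mpr hqQ.isUnit).mul_left_dvd, dvd_iff_isRoot]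
    have h3 : aeval (algebraMap ℚ ℝ ((p : ℚ) / q)) (P.map (Int.castRingHom ℚ)) = 0 := by
      rw [aeval_map_castRingHom_rat, ← h]
      simp
    rw [aeval_algebraMap_apply] at h3
    simpa [IsRoot] using h3
  exact h1

theorem natDegree_linPoly_mul {p q : ℤ} (hq : 0 < q) {R : ℤ[X]} (hR : R ≠ 0) :
    (linPoly p q * R).natDegree = R.natDegree + 1 := by
  rw [natDegree_mul (linPoly_ne_zero hq.ne') hR, natDegree_linPoly hq.ne', add_comm]

/-- The coefficients satisfy `q R_i = P_{i+1} + p R_{i+1}`. Since `|p| ≤ q`, each step down from the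
top degree adds at most `H(P)` to the bound for `q |R_i|`. -/
theorem mul_polyHeight_le_of_linPoly_mul {p q : ℤ} (hp : |(p : ℝ)| ≤ q) (hq : 0 < q) {R : ℤ[X]}
    (hR : R ≠ 0) :
    q * (polyHeight R : ℝ) ≤
      ((linPoly p q * R).natDegree + 1) * polyHeight (linPoly p q * R) := by
  set P := linPoly p q * R with hP
  have hq' : (0 : ℝ) < q := by exact_mod_cast hq
  have hdeg : P.natDegree = R.natDegree + 1 := natDegree_linPoly_mul hq hR
  have hH : (0 : ℝ) ≤ polyHeight P := Nat.cast_nonneg _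
  have key : ∀ m i : ℕ, P.natDegree + 1 ≤ i + m →
      q * |(R.coeff i : ℝ)| ≤ m * polyHeight P := by
    intro m
    induction m with
    | zero =>
      intro i hi
      rw [coeff_eq_zero_of_natDegree_lt (by omega)]
      simp
    | succ m ih =>
      intro i hi
      have h1 : P.coeff (i + 1) = q * R.coeff i - p * R.coeff (i + 1) := by
        rw [hP, linPoly, sub_mul, mul_assoc, coeff_sub, coeff_C_mul, coeff_C_mul, coeff_X_mul]
      have h2 : (q : ℝ) * R.coeff i = P.coeff (i + 1) + p * R.coeff (i + 1) := by
        rw [h1]; push_cast; ring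
      calc q * |(R.coeff i : ℝ)| = |(q : ℝ) * R.coeff i| := by rw [abs_mul, abs_of_pos hq']
        _ ≤ |(P.coeff (i + 1) : ℝ)| + |(p : ℝ)| * |(R.coeff (i + 1) : ℝ)| := by
            rw [h2, ← abs_mul]; exact abs_add_le _ _
        _ ≤ polyHeight P + q * |(R.coeff (i + 1) : ℝ)| := by
            gcongr; exact abs_coeff_le_polyHeight _ _
        _ ≤ polyHeight P + m * polyHeight P := by
            exact add_le_add_right (ih (i + 1) (by omega)) _
        _ = _ := by push_cast; ring
  rw [mul_comm, ← le_div_iff₀ hq']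
  refine polyHeight_le (by positivity) fun i => ?_
  rw [le_div_iff₀ hq', mul_comm]
  have := key (P.natDegree + 1) i (by omega)
  push_cast at this
  exact this

theorem inv_pow_le_abs_aeval_div {P : ℤ[X]} {n : ℕ} (hn : P.natDegree ≤ n) {p q : ℤ} (hq : 0 < q)
    (h : aeval ((p : ℝ) / q) P ≠ 0) : ((q : ℝ) ^ n)⁻¹ ≤ |aeval ((p : ℝ) / q) P| := by
  have hq' : (1 : ℝ) ≤ q := by exact_mod_cast hq
  have h1 := one_le_pow_mul_abs_eval_div (K := ℝ) (f := P) (a := p) hq (by rwa [eval_map_algebraMap])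
  rw [eval_map_algebraMap] at h1
  rw [inv_le_iff_one_le_mul₀ (by positivity), mul_comm]
  refine h1.trans ?_
  gcongr

/-! ### The box principle -/

/-- Dirichlet's box principle for a polynomial with prescribed sizes of its value, its derivative
and its coefficients of index at least two. -/
theorem exists_small_value {n : ℕ} (hn : 1 ≤ n) (ξ : ℝ) {Y B : ℕ} (hY : 1 ≤ Y) (hB : 1 ≤ B) :
    ∃ P : ℤ[X], P ≠ 0 ∧ P.natDegree ≤ n ∧ (∀ j, 2 ≤ j → |(P.coeff j : ℝ)| ≤ Y) ∧
      |aeval ξ (derivative P)| ≤ B + 1 ∧ |aeval ξ P| ≤ 1 / ((Y : ℝ) ^ (n - 1) * B) := by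
  obtain ⟨k, rfl⟩ : ∃ k, n = k + 1 := ⟨n - 1, by omega⟩
  simp only [Nat.add_sub_cancel]
  -- The coefficients of index at least 2 are free in `[0, Y]`. The linear coefficient `b z` then
  -- puts the derivative at `ξ` in `[z.2, z.2 + 1)`, and the constant term reduces the value at `ξ`
  -- modulo 1. The boxes cut `[0, 1)` into `Y^k B` equal parts.
  let R : (Fin k → Fin (Y + 1)) → ℤ[X] := fun y => ∑ i : Fin k, monomial ((i : ℕ) + 2) ((y i : ℕ) : ℤ)
  let b : (Fin k → Fin (Y + 1)) × Fin (B + 1) → ℤ := fun z =>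
    (z.2 : ℕ) - ⌊aeval ξ (derivative (R z.1))⌋
  let F : (Fin k → Fin (Y + 1)) × Fin (B + 1) → ℤ[X] := fun z =>
    R z.1 + C (b z) * X - C ⌊aeval ξ (R z.1) + b z * ξ⌋
  have hRcoeff : ∀ y (j : ℕ), (R y).coeff j =
      if h : 2 ≤ j ∧ j - 2 < k then ((y ⟨j - 2, h.2⟩ : ℕ) : ℤ) else 0 := by
    intro y j
    simp only [R, finsetSum_coeff, coeff_monomial]
    split_ifs with h
    · rw [Finset.sum_eq_single ⟨j - 2, h.2⟩]
      · rw [if_pos]; simp only; omega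
      · intro i _ hi
        rw [if_neg]
        intro h'
        apply hi
        ext
        simp only
        omega
      · simp
    · refine Finset.sum_eq_zero fun i _ => if_neg fun h' => h ⟨by omega, by omega⟩
  have hRdeg : ∀ y, (R y).natDegree ≤ k + 1 := fun y =>
    natDegree_sum_le_of_forall_le _ _ fun i _ => (natDegree_monomial_le _).trans (by omega)
  have hFdeg : ∀ z, (F z).natDegree ≤ k + 1 := fun z => by
    refine (natDegree_sub_C (a := _)).trans_le (natDegree_add_le_of_degree_le (hRdeg _) ?_)
    exact (natDegree_C_mul_le _ _).trans (natDegree_X_le.trans (by omega))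
  have hFval : ∀ z, aeval ξ (F z) = Int.fract (aeval ξ (R z.1) + b z * ξ) := fun z => by
    simp only [F, map_sub, map_add, map_mul, aeval_C, aeval_X, ← Int.self_sub_floor]
    simp
  have hFder : ∀ z, aeval ξ (derivative (F z)) =
      (z.2 : ℕ) + Int.fract (aeval ξ (derivative (R z.1))) := fun z => by
    rw [← Int.self_sub_floor]
    simp [F, b, -Int.self_sub_floor]
    ring
  have hF2 : ∀ z j, 2 ≤ j → (F z).coeff j = (R z.1).coeff j := fun z j hj => by
    obtain ⟨j, rfl⟩ : ∃ i, j = i + 2 := ⟨j - 2, by omega⟩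
    simp [-eq_intCast, F]
  have hF1 : ∀ z, (F z).coeff 1 = b z := fun z => by
    simp [-eq_intCast, F, coeff_C, hRcoeff]
  have hR2 : ∀ y (j : ℕ), (0 : ℝ) ≤ (R y).coeff j ∧ ((R y).coeff j : ℝ) ≤ Y := by
    intro y j
    rw [hRcoeff]
    split_ifs with h
    · have := (y ⟨j - 2, h.2⟩).2
      constructor
      · positivity
      · have h3 : ((y ⟨j - 2, h.2⟩ : ℕ)) ≤ Y := by omega
        exact_mod_cast h3
    · simp
  set N := Y ^ k * B with hN
  have hNpos : 0 < N := by positivity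
  have hNR : (0 : ℝ) < N := by exact_mod_cast hNpos
  have hbox : ∀ z, ⌊N * Int.fract (aeval ξ (R z.1) + b z * ξ)⌋₊ < N := fun z => by
    rw [Nat.floor_lt (by have := Int.fract_nonneg (aeval ξ (R z.1) + b z * ξ); positivity)]
    calc _ < (N : ℝ) * 1 := by gcongr; exact Int.fract_lt_one _
      _ = _ := mul_one _
  let box : (Fin k → Fin (Y + 1)) × Fin (B + 1) → Fin N := fun z => ⟨_, hbox z⟩
  have hcard : Fintype.card (Fin N) < Fintype.card ((Fin k → Fin (Y + 1)) × Fin (B + 1)) := by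
    simp only [Fintype.card_fin, Fintype.card_prod, Fintype.card_fun, hN]
    calc Y ^ k * B < Y ^ k * (B + 1) := by
          have : 0 < Y ^ k := by positivity
          exact Nat.mul_lt_mul_of_pos_left (by omega) this
      _ ≤ (Y + 1) ^ k * (B + 1) := by gcongr; omega
  obtain ⟨z, z', hne, hzz⟩ := Fintype.exists_ne_map_eq_of_card_lt box hcard
  refine ⟨F z - F z', ?_, ?_, ?_, ?_, ?_⟩
  · intro h
    apply hne
    have hc : ∀ j, (F z).coeff j = (F z').coeff j := fun j => by rw [sub_eq_zero.mp h]
    have h1 : z.1 = z'.1 := by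
      funext i
      have := hc (i + 2)
      rw [hF2 _ _ (by omega), hF2 _ _ (by omega), hRcoeff, hRcoeff] at this
      simp only [Nat.add_sub_cancel, i.2, and_true, le_add_iff_nonneg_left, zero_le, dite_true,
        Nat.cast_inj] at this
      exact Fin.ext this
    have h2 : z.2 = z'.2 := by
      have := hc 1
      rw [hF1, hF1] at this
      simp only [b, h1, sub_left_inj, Nat.cast_inj] at this
      exact Fin.ext this
    exact Prod.ext h1 h2
  · exact (natDegree_sub_le_of_le (hFdeg _) (hFdeg _)).trans (by simp)
  · intro j hj
    rw [coeff_sub, hF2 _ _ hj, hF2 _ _ hj, Int.cast_sub, abs_le]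
    constructor <;> linarith [hR2 z.1 j, hR2 z'.1 j]
  · rw [derivative_sub, map_sub, hFder, hFder, abs_le]
    have h1 : ((z.2 : ℕ) : ℝ) ≤ B := by exact_mod_cast Nat.lt_succ_iff.mp z.2.2
    have h2 : ((z'.2 : ℕ) : ℝ) ≤ B := by exact_mod_cast Nat.lt_succ_iff.mp z'.2.2
    have h3 : (0 : ℝ) ≤ (z.2 : ℕ) := Nat.cast_nonneg _
    have h4 : (0 : ℝ) ≤ (z'.2 : ℕ) := Nat.cast_nonneg _
    have e1 := Int.fract_nonneg (aeval ξ (derivative (R z.1)))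
    have e2 := Int.fract_nonneg (aeval ξ (derivative (R z'.1)))
    have e3 := Int.fract_lt_one (aeval ξ (derivative (R z.1)))
    have e4 := Int.fract_lt_one (aeval ξ (derivative (R z'.1)))
    constructor <;> linarith
  · rw [map_sub, hFval, hFval]
    have hfl : ⌊N * Int.fract (aeval ξ (R z.1) + b z * ξ)⌋₊ =
        ⌊N * Int.fract (aeval ξ (R z'.1) + b z' * ξ)⌋₊ := congrArg Fin.val hzz
    have e1 := Int.fract_nonneg (aeval ξ (R z.1) + b z * ξ)
    have e2 := Int.fract_nonneg (aeval ξ (R z'.1) + b z' * ξ)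
    generalize Int.fract (aeval ξ (R z.1) + b z * ξ) = s at *
    generalize Int.fract (aeval ξ (R z'.1) + b z' * ξ) = t at *
    have hNe : (Y : ℝ) ^ k * B = N := by rw [hN]; push_cast; rfl
    rw [hNe, le_div_iff₀ hNR]
    have f1 := Nat.floor_le (mul_nonneg hNR.le e1)
    have f2 := Nat.floor_le (mul_nonneg hNR.le e2)
    have f3 := Nat.lt_floor_add_one ((N : ℝ) * s)
    have f4 := Nat.lt_floor_add_one ((N : ℝ) * t)
    rw [hfl] at f1 f3
    have : |s - t| * N = |N * s - N * t| := by
      rw [← mul_sub, abs_mul, abs_of_pos hNR, mul_comm]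
    rw [this, abs_le]
    constructor <;> linarith

/-! ### Construction of transcendental numbers with prescribed convergents -/

/-- A real number `ξ` together with rational approximations `p k / q k` such that `q (k + 1)` has
the order of magnitude of `q k ^ w k` and `ξ - p k / q k` that of `1 / (q k * q (k + 1))`. -/
structure RapidApprox (ξ : ℝ) (p q : ℕ → ℤ) (w : ℕ → ℝ) : Prop where
  pos : 0 < ξ
  lt_one : ξ < 1
  two_le : ∀ k, 2 ≤ q k
  num_nonneg : ∀ k, 0 ≤ p k
  num_le : ∀ k, p k ≤ q k
  coprime : ∀ k, IsCoprime (p k) (q k)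
  two_mul_le : ∀ k, 2 * q k ≤ q (k + 1)
  rpow_le : ∀ k, (q k : ℝ) ^ w k ≤ q (k + 1)
  le_rpow : ∀ k, (q (k + 1) : ℝ) ≤ 6 * (q k : ℝ) ^ w k
  le_sub : ∀ k, 1 / ((q k : ℝ) * q (k + 1)) ≤ ξ - p k / q k
  sub_le : ∀ k, ξ - p k / q k ≤ 2 / ((q k : ℝ) * q (k + 1))

/-- Two consecutive multipliers `a`, `a + 1` give admissible denominators `S` and `S + q`, with
fractions `p/q + 1/(qS)` and `p/q + 1/(q(S + q))`. These differ by `1/(S(S + q)) > 1/(S + q)^2`, so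
for any `e` at least one choice keeps `e` out of the interval left for the limit. -/
theorem exists_next_convergent {p q p' q' : ℤ} (hq : 2 ≤ q) (hq'0 : 0 ≤ q') (hq' : q' ≤ q)
    (hdet : p * q' - p' * q = 1) {w : ℝ} (hw : 1 ≤ w) (e : ℝ) :
    ∃ r s : ℤ, 2 * q ≤ s ∧ r * q - p * s = 1 ∧ (q : ℝ) ^ w ≤ s ∧ (s : ℝ) ≤ 6 * (q : ℝ) ^ w ∧
      (e ≤ r / s ∨ (r : ℝ) / s + 1 / (s : ℝ) ^ 2 < e) := by
  have hqR : (2 : ℝ) ≤ q := by exact_mod_cast hq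
  have hq'R : (q' : ℝ) ≤ q := by exact_mod_cast hq'
  have hq'0R : (0 : ℝ) ≤ q' := by exact_mod_cast hq'0
  set z : ℝ := (q : ℝ) ^ (w - 1) with hz
  have hz1 : 1 ≤ z := Real.one_le_rpow (by linarith) (by linarith)
  have hzq : z * q = (q : ℝ) ^ w := by
    rw [hz, ← Real.rpow_add_one (by linarith)]; ring_nf
  set a : ℤ := ⌈z⌉ + 3 with ha
  have ha1 : z + 3 ≤ a := by rw [ha]; push_cast; linarith [Int.le_ceil z]
  have ha2 : (a : ℝ) ≤ z + 4 := by rw [ha]; push_cast; linarith [Int.ceil_lt_add_one z]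
  have ha4 : 4 ≤ a := by
    have : (4 : ℝ) ≤ a := by linarith
    exact_mod_cast this
  have l1 : (z + 3) * q ≤ a * q := by gcongr
  have l2 : (a : ℝ) * q ≤ (z + 4) * q := by gcongr
  have l3 : (1 : ℝ) * q ≤ z * q := by gcongr
  have hs : 2 * q ≤ a * q - q' := by nlinarith
  by_cases he : e ≤ ((a * p - p' : ℤ) : ℝ) / ((a * q - q' : ℤ) : ℝ)
  · refine ⟨a * p - p', a * q - q', hs, by linear_combination hdet, ?_, ?_, Or.inl he⟩
    · push_cast; linarith
    · push_cast; linarith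
  · refine ⟨a * p - p' + p, a * q - q' + q, by linarith, by linear_combination hdet, ?_, ?_,
      Or.inr ?_⟩
    · push_cast; linarith
    · push_cast; linarith
    · refine lt_of_le_of_lt ?_ (not_le.mp he)
      have hsR : (2 : ℝ) * q ≤ a * q - q' := by exact_mod_cast hs
      have hdetR : (p : ℝ) * q' - p' * q = 1 := by exact_mod_cast hdet
      push_cast
      set S : ℝ := a * q - q'
      have hS : 0 < S := by linarith
      have hT : 0 < S + q := by linarith
      rw [div_add_div _ _ hT.ne' (by positivity), div_le_div_iff₀ (by positivity) hS]
      have hid : (a * p - p' : ℝ) * (S + q) = (a * p - p' + p) * S + 1 := by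
        simp only [S]; linear_combination hdetR
      have : ((a * p - p' + p : ℝ) * (S + q) ^ 2 + (S + q) * 1) * S
          ≤ ((a * p - p' + p) * S + 1) * (S + q) ^ 2 := by nlinarith
      calc _ ≤ _ := this
        _ = _ := by rw [← hid]; ring

theorem exists_convergents {w : ℕ → ℝ} (hw : ∀ k, 1 ≤ w k) (e : ℕ → ℝ) :
    ∃ p q : ℕ → ℤ, p 0 = 1 ∧ q 0 = 2 ∧ (∀ k, 2 * q k ≤ q (k + 1)) ∧
      (∀ k, p (k + 1) * q k - p k * q (k + 1) = 1) ∧ (∀ k, (q k : ℝ) ^ w k ≤ q (k + 1)) ∧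
      (∀ k, (q (k + 1) : ℝ) ≤ 6 * (q k : ℝ) ^ w k) ∧
      (∀ k, e k ≤ p (k + 1) / q (k + 1) ∨
        (p (k + 1) : ℝ) / q (k + 1) + 1 / (q (k + 1) : ℝ) ^ 2 < e k) := by
  let S := {s : (ℤ × ℤ) × (ℤ × ℤ) // 2 ≤ s.1.2 ∧ 0 ≤ s.2.2 ∧ s.2.2 ≤ s.1.2 ∧
    s.1.1 * s.2.2 - s.2.1 * s.1.2 = 1}
  have hstep : ∀ (k : ℕ) (s : S), ∃ t : S, t.1.2 = s.1.1 ∧ 2 * s.1.1.2 ≤ t.1.1.2 ∧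
      t.1.1.1 * s.1.1.2 - s.1.1.1 * t.1.1.2 = 1 ∧ (s.1.1.2 : ℝ) ^ w k ≤ t.1.1.2 ∧
      (t.1.1.2 : ℝ) ≤ 6 * (s.1.1.2 : ℝ) ^ w k ∧
      (e k ≤ t.1.1.1 / t.1.1.2 ∨ (t.1.1.1 : ℝ) / t.1.1.2 + 1 / (t.1.1.2 : ℝ) ^ 2 < e k) := by
    rintro k ⟨⟨⟨p, q⟩, p', q'⟩, h1, h2, h3, h4⟩
    obtain ⟨r, s, hs1, hs2, hs3⟩ := exists_next_convergent h1 h2 h3 h4 (hw k) (e k)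
    simp only at h1 h2 h3 h4 hs1
    have g1 : 2 ≤ s := by omega
    have g2 : 0 ≤ q := by omega
    have g3 : q ≤ s := by omega
    exact ⟨⟨⟨(r, s), (p, q)⟩, g1, g2, g3, hs2⟩, rfl, hs1, hs2, hs3⟩
  choose F hF using hstep
  let s : ℕ → S := fun k => Nat.rec ⟨⟨(1, 2), (0, 1)⟩, by norm_num⟩ F k
  have hs : ∀ k, s (k + 1) = F k (s k) := fun _ => rfl
  refine ⟨fun k => (s k).1.1.1, fun k => (s k).1.1.2, rfl, rfl, ?_, ?_, ?_, ?_, ?_⟩ <;> intro k <;>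
    obtain ⟨-, h1, h2, h3, h4, h5⟩ := hF k (s k)
  exacts [h1, h2, h3, h4, h5]

/-- Transcendental numbers with prescribed growth of the denominators of their convergents. -/
theorem exists_transcendental_rapidApprox {w : ℕ → ℝ} (hw : ∀ k, 1 ≤ w k) :
    ∃ ξ : ℝ, Transcendental ℚ ξ ∧ ∃ p q, RapidApprox ξ p q w := by
  -- Diagonal argument: stage `k` excludes the algebraic number `e k`, since the limit lies strictly
  -- above `p_{k+1}/q_{k+1}` and at most `1/q_{k+1}^2` beyond it.
  obtain ⟨e, he⟩ := (Algebraic.countable ℚ ℝ).exists_eq_range ⟨0, isAlgebraic_zero⟩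
  obtain ⟨p, q, hp0, hq0, h2, hdet, hlo, hup, havoid⟩ := exists_convergents hw e
  have hq : ∀ k, 2 ≤ q k := by
    intro k
    induction k with
    | zero => omega
    | succ k ih => linarith [h2 k]
  have hqR : ∀ k, (2 : ℝ) ≤ q k := fun k => by exact_mod_cast hq k
  have hqpos : ∀ k, (0 : ℝ) < q k := fun k => by linarith [hqR k]
  have h2R : ∀ k, (2 : ℝ) * q k ≤ q (k + 1) := fun k => by exact_mod_cast h2 k
  let u : ℕ → ℝ := fun k => p k / q k
  -- The numerator 2 makes the intervals `[u k, v k]` nested: half of the length is used to reach `u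
  -- (k + 1)`, and the doubling of denominators makes the next interval fit in the other half.
  let v : ℕ → ℝ := fun k => u k + 2 / (q k * q (k + 1))
  have hu : ∀ k, u (k + 1) = u k + 1 / (q k * q (k + 1)) := by
    intro k
    have hd : (p (k + 1) : ℝ) * q k - p k * q (k + 1) = 1 := by exact_mod_cast hdet k
    have := (hqpos k).ne'
    have := (hqpos (k + 1)).ne'
    simp only [u]
    field_simp
    linarith
  have hinv : ∀ k, 2 / ((q (k + 1) : ℝ) * q (k + 2)) ≤ 1 / (q k * q (k + 1)) := by
    intro k
    have h0 := hqpos k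
    have h1 := hqpos (k + 1)
    have h3 := hqpos (k + 2)
    rw [div_le_div_iff₀ (by positivity) (by positivity)]
    have := h2R (k + 1)
    have := h2R k
    nlinarith
  have hmono : Monotone u := monotone_nat_of_le_succ fun k => by
    have h0 := hqpos k
    have h1 := hqpos (k + 1)
    have : 0 < 1 / ((q k : ℝ) * q (k + 1)) := by positivity
    linarith [hu k]
  have hanti : Antitone v := antitone_nat_of_succ_le fun k => by
    have h4 := hinv k
    have h5 : 2 / ((q k : ℝ) * q (k + 1)) = 1 / (q k * q (k + 1)) + 1 / (q k * q (k + 1)) := by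
      ring
    simp only [v]
    linarith [hu k]
  have huv : u ≤ v := fun k => by
    have h0 := hqpos k
    have h1 := hqpos (k + 1)
    have : 0 < 2 / ((q k : ℝ) * q (k + 1)) := by positivity
    simp only [v]
    linarith
  have hmem := hmono.ciSup_mem_iInter_Icc_of_antitone hanti huv
  rw [Set.mem_iInter] at hmem
  set ξ := ⨆ k, u k
  have hu0 : u 0 = 1 / 2 := by simp [u, hp0, hq0]
  have hv0 : v 0 ≤ 3 / 4 := by
    have h8 : (8 : ℝ) ≤ q 0 * q 1 := by
      have := h2R 0
      rw [hq0] at this ⊢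
      push_cast at this ⊢
      linarith
    have : 2 / ((q 0 : ℝ) * q 1) ≤ 2 / 8 := by gcongr
    simp only [v, hu0]
    linarith
  have hlt : ∀ k, u k < ξ := fun k => by
    have h0 := hqpos k
    have h1 := hqpos (k + 1)
    have : 0 < 1 / ((q k : ℝ) * q (k + 1)) := by positivity
    linarith [hu k, (hmem (k + 1)).1]
  have hξ1 : ξ < 1 := by linarith [(hmem 0).2]
  refine ⟨ξ, fun halg => ?_, p, q, ?_⟩
  · obtain ⟨k, hk⟩ : ξ ∈ Set.range e := he ▸ halg
    rcases havoid k with h | h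
    · have := hlt (k + 1)
      rw [← hk] at this
      exact absurd h (not_le.mpr this)
    · have h3 := (hmem (k + 1)).2
      have h4 : 2 / ((q (k + 1) : ℝ) * q (k + 2)) ≤ 1 / (q (k + 1) : ℝ) ^ 2 := by
        have h1 := hqpos (k + 1)
        have h5 := hqpos (k + 2)
        rw [div_le_div_iff₀ (by positivity) (by positivity)]
        nlinarith [h2R (k + 1)]
      rw [hk] at h
      simp only [v, u] at h3
      exact absurd (h3.trans (add_le_add_right h4 _)) (not_le.mpr h)
  · have hunn : ∀ k, 0 ≤ u k := fun k => by linarith [hmono (Nat.zero_le k)]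
    refine ⟨by linarith [(hmem 0).1], hξ1, hq, fun k => ?_, fun k => ?_, fun k => ?_, h2, hlo, hup,
      fun k => ?_, fun k => ?_⟩
    · have := mul_nonneg (hunn k) (hqpos k).le
      rw [div_mul_cancel₀ _ (hqpos k).ne'] at this
      exact_mod_cast this
    · have : u k ≤ 1 := by linarith [hlt k]
      rw [div_le_one (hqpos k)] at this
      exact_mod_cast this
    · exact ⟨-q (k + 1), p (k + 1), by linear_combination hdet k⟩
    · linarith [hu k, (hmem (k + 1)).1]
    · have := (hmem k).2
      simp only [v] at this
      linarith

/-! ### Lower bounds for integer polynomials at `ξ` -/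

namespace RapidApprox

variable {ξ : ℝ} {p q : ℕ → ℤ} {w : ℕ → ℝ}

theorem two_le_cast (h : RapidApprox ξ p q w) (k : ℕ) : (2 : ℝ) ≤ q k := by
  exact_mod_cast h.two_le k

theorem one_le_cast (h : RapidApprox ξ p q w) (k : ℕ) : (1 : ℝ) ≤ q k := by
  linarith [h.two_le_cast k]

theorem cast_pos (h : RapidApprox ξ p q w) (k : ℕ) : (0 : ℝ) < q k := by
  linarith [h.two_le_cast k]

theorem den_pos (h : RapidApprox ξ p q w) (k : ℕ) : 0 < q k := by
  linarith [h.two_le k]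

theorem abs_num_le (h : RapidApprox ξ p q w) (k : ℕ) : |(p k : ℝ)| ≤ q k := by
  rw [abs_of_nonneg (by exact_mod_cast h.num_nonneg k)]
  exact_mod_cast h.num_le k

theorem abs_div_le_one (h : RapidApprox ξ p q w) (k : ℕ) : |(p k : ℝ) / q k| ≤ 1 := by
  rw [abs_div, abs_of_pos (h.cast_pos k), div_le_one (h.cast_pos k)]
  exact h.abs_num_le k

theorem abs_le_one (h : RapidApprox ξ p q w) : |ξ| ≤ 1 := by
  rw [abs_of_pos h.pos]; exact h.lt_one.le

theorem strictMono (h : RapidApprox ξ p q w) : StrictMono q :=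
  strictMono_nat_of_lt_succ fun k => by linarith [h.two_mul_le k, h.two_le k]

theorem tendsto (h : RapidApprox ξ p q w) : Tendsto (fun k => (q k : ℝ)) atTop atTop := by
  refine tendsto_intCast_atTop_iff.mpr (tendsto_atTop_mono (fun k => ?_) tendsto_natCast_atTop_atTop)
  induction k with
  | zero => simpa using (h.den_pos 0).le
  | succ k ih => push_cast; linarith [h.strictMono (Nat.lt_succ_self k)]

theorem sub_pos (h : RapidApprox ξ p q w) (k : ℕ) : 0 < ξ - p k / q k := by
  refine lt_of_lt_of_le ?_ (h.le_sub k)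
  have := h.cast_pos k
  have := h.cast_pos (k + 1)
  positivity

theorem pow_le_next (h : RapidApprox ξ p q w) {n k : ℕ} (hw : n ≤ w k) :
    (q k : ℝ) ^ n ≤ q (k + 1) := by
  refine le_trans ?_ (h.rpow_le k)
  rw [← Real.rpow_natCast]
  exact Real.rpow_le_rpow_of_exponent_le (h.one_le_cast k) hw

/-- A polynomial of small height that does not vanish at a convergent is not small at `ξ`. -/
theorem inv_le_abs_aeval (h : RapidApprox ξ p q w) {P : ℤ[X]} {n k : ℕ} (hn : P.natDegree ≤ n)
    (hP : aeval ((p k : ℝ) / q k) P ≠ 0)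
    (hH : 4 * taylorConst n * polyHeight P * (q k : ℝ) ^ n ≤ q k * q (k + 1)) :
    (2 * (q k : ℝ) ^ n)⁻¹ ≤ |aeval ξ P| := by
  have h0 := h.cast_pos k
  have h1 := h.cast_pos (k + 1)
  have e1 := inv_pow_le_abs_aeval_div hn (h.den_pos k) hP
  have e2 := abs_aeval_sub_aeval_le hn (x := ξ) (y := (p k : ℝ) / q k)
    (by linarith [h.abs_le_one]) (by linarith [h.abs_div_le_one k])
  rw [abs_of_pos (h.sub_pos k)] at e2
  have hK := one_le_taylorConst n
  have e3 : taylorConst n * polyHeight P * (ξ - p k / q k) ≤ (2 * (q k : ℝ) ^ n)⁻¹ := by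
    calc _ ≤ taylorConst n * polyHeight P * (2 / ((q k : ℝ) * q (k + 1))) := by
          gcongr; exact h.sub_le k
      _ ≤ _ := by
          rw [mul_div_assoc', inv_eq_one_div, div_le_div_iff₀ (by positivity) (by positivity)]
          linarith
  have e4 : (2 * (q k : ℝ) ^ n)⁻¹ = ((q k : ℝ) ^ n)⁻¹ / 2 := by
    rw [mul_inv]; ring
  have e5 := abs_sub_abs_le_abs_sub (aeval ((p k : ℝ) / q k) P) (aeval ξ P)
  rw [abs_sub_comm] at e5
  linarith

/-- For the least `k` with `K H q_k^n ≤ q_k q_{k+1}`, the value at `ξ` is at least `1/(2 q_k^n)`.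
Minimality gives `q_k ≤ K H q_{k-1}^{n-1}`, hence `q_k^{W-n+1} ≤ (K H)^W`. -/
theorem rpow_neg_le_abs_aeval_of_coprime {W : ℝ} {n : ℕ} (hn : 1 ≤ n) (hW : 2 * (n : ℝ) - 1 ≤ W)
    (h : RapidApprox ξ p q fun _ => W) :
    ∃ c : ℝ, 0 < c ∧ ∀ P : ℤ[X], P ≠ 0 → P.natDegree ≤ n →
      (∀ k, aeval ((p k : ℝ) / q k) P ≠ 0) → c * (polyHeight P : ℝ) ^ (-W) ≤ |aeval ξ P| := by
  have hn' : (1 : ℝ) ≤ n := by exact_mod_cast hn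
  have hW0 : 0 < W := by linarith
  set K := 4 * taylorConst n with hK
  have hK1 : 1 ≤ K := by linarith [one_le_taylorConst n]
  have hq0 := h.cast_pos 0
  refine ⟨min (2 * (q 0 : ℝ) ^ n)⁻¹ (K ^ (-W) / 2), by positivity, fun P hP hPn hPk => ?_⟩
  have hH := one_le_polyHeight hP
  set H : ℝ := (polyHeight P : ℝ)
  have hHW : H ^ (-W) ≤ 1 := Real.rpow_le_one_of_one_le_of_nonpos hH (by linarith)
  have hHW0 : 0 < H ^ (-W) := by positivity
  have hex : ∃ k, K * H * (q k : ℝ) ^ n ≤ q k * q (k + 1) := by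
    obtain ⟨k, hk⟩ := (h.tendsto.eventually_ge_atTop (K * H)).exists
    refine ⟨k, ?_⟩
    have := h.pow_le_next (n := n) (k := k) (by linarith)
    have := h.cast_pos k
    gcongr
  classical
  have hspec := Nat.find_spec hex
  have hmin := fun j => Nat.find_min (H := hex) (m := j)
  generalize Nat.find hex = k at hspec hmin
  have hval := h.inv_le_abs_aeval hPn (hPk k) hspec
  clear_value K
  rcases k with _ | j
  · calc _ ≤ (2 * (q 0 : ℝ) ^ n)⁻¹ * 1 := by
          gcongr; exact min_le_left _ _
      _ ≤ _ := by rw [mul_one]; exact hval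
  · have hlt := not_le.mp (hmin j (Nat.lt_succ_self j))
    obtain ⟨m, rfl⟩ : ∃ m, n = m + 1 := ⟨n - 1, by omega⟩
    have hx := h.cast_pos j
    have hy := h.cast_pos (j + 1)
    have hy1 := h.one_le_cast (j + 1)
    have hxy := h.rpow_le j
    generalize (q j : ℝ) = x at *
    generalize (q (j + 1) : ℝ) = y at *
    have h1 : y ≤ K * H * x ^ m := by
      have : y * x ≤ K * H * x ^ m * x := by
        rw [pow_succ] at hlt; linarith
      exact le_of_mul_le_mul_right this hx
    have h2 : y ^ W ≤ (K * H) ^ W * y ^ m := by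
      calc y ^ W ≤ (K * H * x ^ m) ^ W := Real.rpow_le_rpow hy.le h1 hW0.le
        _ = (K * H) ^ W * (x ^ W) ^ m := by
            rw [Real.mul_rpow (by positivity) (by positivity), ← Real.rpow_natCast,
              ← Real.rpow_natCast, ← Real.rpow_mul hx.le, ← Real.rpow_mul hx.le, mul_comm (m : ℝ)]
        _ ≤ _ := by gcongr
    -- This is where `W ≥ 2n - 1` enters: it says that `W - (n - 1) ≥ n`.
    have h3 : y ^ (m + 1) ≤ (K * H) ^ W := by
      have : y ^ (m + 1) * y ^ m ≤ (K * H) ^ W * y ^ m := by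
        refine le_trans ?_ h2
        rw [← pow_add, ← Real.rpow_natCast]
        refine Real.rpow_le_rpow_of_exponent_le hy1 ?_
        push_cast at hW ⊢
        linarith
      exact le_of_mul_le_mul_right this (by positivity)
    calc _ ≤ K ^ (-W) / 2 * H ^ (-W) := by gcongr; exact min_le_right _ _
      _ = (2 * (K * H) ^ W)⁻¹ := by
          rw [mul_inv, Real.mul_rpow (by positivity) (by positivity), mul_inv,
            Real.rpow_neg (by positivity), Real.rpow_neg (by positivity)]
          ring
      _ ≤ (2 * y ^ (m + 1))⁻¹ := by gcongr
      _ ≤ _ := hval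

/-- The exponent `w_n` of a number with convergents growing with exponent `W ≥ 2 n - 1` is at most
`W`. -/
theorem rpow_neg_le_abs_aeval {W : ℝ} {n : ℕ} (hn : 1 ≤ n) (hW : 2 * (n : ℝ) - 1 ≤ W)
    (h : RapidApprox ξ p q fun _ => W) :
    ∃ c : ℝ, 0 < c ∧ ∀ P : ℤ[X], P ≠ 0 → P.natDegree ≤ n →
      c * (polyHeight P : ℝ) ^ (-W) ≤ |aeval ξ P| := by
  have hn' : (1 : ℝ) ≤ n := by exact_mod_cast hn
  have hW0 : 0 < W := by linarith
  obtain ⟨c₀, hc₀, hcop⟩ := h.rpow_neg_le_abs_aeval_of_coprime hn hW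
  -- Induction on a degree bound `d`, with `n` fixed in the constants. A factor `q_k X - p_k` has
  -- value at least `q_k^{-W}/6` at `ξ`, while the cofactor's height is smaller by a factor `q_k/(n
  -- + 1)`, so the exponent `W` is preserved.
  have key : ∀ d : ℕ, ∃ c : ℝ, 0 < c ∧ ∀ P : ℤ[X], P ≠ 0 → P.natDegree ≤ d → P.natDegree ≤ n →
      c * (polyHeight P : ℝ) ^ (-W) ≤ |aeval ξ P| := by
    intro d
    induction d with
    | zero =>
      refine ⟨c₀, hc₀, fun P hP hd hPn => hcop P hP hPn fun k hk => ?_⟩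
      obtain ⟨R, rfl⟩ := exists_eq_linPoly_mul (h.coprime k) (h.den_pos k) hk
      rw [natDegree_linPoly_mul (h.den_pos k) (right_ne_zero_of_mul hP)] at hd
      omega
    | succ d ih =>
      obtain ⟨c, hc, hcP⟩ := ih
      refine ⟨min c₀ (c / 6 * ((n : ℝ) + 1) ^ (-W)), by positivity, fun P hP hd hPn => ?_⟩
      have hH := one_le_polyHeight hP
      by_cases hk : ∀ k, aeval ((p k : ℝ) / q k) P ≠ 0
      · refine le_trans ?_ (hcop P hP hPn hk)
        gcongr
        exact min_le_left _ _
      · push Not at hk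
        obtain ⟨k, hk⟩ := hk
        obtain ⟨R, rfl⟩ := exists_eq_linPoly_mul (h.coprime k) (h.den_pos k) hk
        have hR := right_ne_zero_of_mul hP
        have hRH := one_le_polyHeight hR
        have hRd := natDegree_linPoly_mul (p := p k) (h.den_pos k) hR
        have hq := h.cast_pos k
        have hq' := h.cast_pos (k + 1)
        have h1 := mul_polyHeight_le_of_linPoly_mul (h.abs_num_le k) (h.den_pos k) hR
        have h2 : q k * (polyHeight R : ℝ) ≤ (n + 1) * polyHeight (linPoly (p k) (q k) * R) := by
          refine h1.trans ?_
          gcongr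
        have h3 : 1 / 6 * (q k : ℝ) ^ (-W) ≤ |aeval ξ (linPoly (p k) (q k))| := by
          have e1 : (q k : ℝ) * ξ - p k = q k * (ξ - p k / q k) := by field_simp
          rw [aeval_linPoly, e1, abs_of_pos (mul_pos hq (h.sub_pos k))]
          calc _ = 1 / (6 * (q k : ℝ) ^ W) := by
                rw [Real.rpow_neg hq.le, one_div, one_div, mul_inv]
            _ ≤ 1 / (q (k + 1) : ℝ) := by gcongr; exact h.le_rpow k
            _ = q k * (1 / ((q k : ℝ) * q (k + 1))) := by field_simp
            _ ≤ _ := by gcongr; exact h.le_sub k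
        have h4 := hcP R hR (by omega) (by omega)
        rw [map_mul, abs_mul]
        calc _ ≤ c / 6 * ((n : ℝ) + 1) ^ (-W) *
              (polyHeight (linPoly (p k) (q k) * R) : ℝ) ^ (-W) := by
              gcongr; exact min_le_right _ _
          _ = c / 6 * ((n + 1) * polyHeight (linPoly (p k) (q k) * R) : ℝ) ^ (-W) := by
              rw [Real.mul_rpow (by positivity) (by positivity), mul_assoc]
          _ ≤ c / 6 * (q k * polyHeight R : ℝ) ^ (-W) := by
              gcongr ?_ * ?_
              exact Real.rpow_le_rpow_of_nonpos (by positivity) h2 (by linarith)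
          _ = (1 / 6 * (q k : ℝ) ^ (-W)) * (c * (polyHeight R : ℝ) ^ (-W)) := by
              rw [Real.mul_rpow (by positivity) (by positivity)]; ring
          _ ≤ _ := by gcongr
  obtain ⟨c, hc, hcP⟩ := key n
  exact ⟨c, hc, fun P hP hPn => hcP P hP hPn hPn⟩

end RapidApprox

/-! ### Simultaneous approximation and `λ_n` -/

theorem coe_le_sSup_image_coe {S : Set ℝ} {a : ℝ} (h : ∀ l < a, l ∈ S) :
    (a : EReal) ≤ sSup ((fun l : ℝ => (l : EReal)) '' S) := by
  refine le_of_forall_lt fun c hc => ?_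
  obtain ⟨l, h1, h2⟩ := EReal.lt_iff_exists_real_btwn.mp hc
  exact h1.trans_le (le_sSup ⟨l, h l (EReal.coe_lt_coe_iff.mp h2), rfl⟩)

theorem sSup_image_coe_le {S : Set ℝ} {a : ℝ} (h : ∀ l ∈ S, l ≤ a) :
    sSup ((fun l : ℝ => (l : EReal)) '' S) ≤ a := by
  refine sSup_le ?_
  rintro _ ⟨l, hl, rfl⟩
  exact EReal.coe_le_coe_iff.mpr (h l hl)

theorem eventually_mul_rpow_lt_rpow {a b : ℝ} (hab : a < b) (K : ℝ) :
    ∀ᶠ x : ℝ in atTop, K * x ^ a < x ^ b := by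
  filter_upwards [(tendsto_rpow_atTop (sub_pos.mpr hab)).eventually_gt_atTop K,
    eventually_gt_atTop 0] with x hx hx0
  calc K * x ^ a < x ^ (b - a) * x ^ a := by gcongr
    _ = x ^ b := by rw [← Real.rpow_add hx0]; ring_nf

namespace RapidApprox

variable {ξ : ℝ} {p q : ℕ → ℤ} {w : ℕ → ℝ} {n : ℕ}

theorem le_lambda (h : RapidApprox ξ p q w) (hn : 1 ≤ n) {W : ℝ} (hW : ∀ᶠ k in atTop, W ≤ w k) :
    (((W - n + 1) / n : ℝ) : EReal) ≤ lambda n ξ := by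
  have hn0 : (0 : ℝ) < n := by exact_mod_cast hn
  refine coe_le_sSup_image_coe fun l hl => ?_
  rw [lt_div_iff₀ hn0] at hl
  have hev := h.tendsto.eventually
    (eventually_mul_rpow_lt_rpow (a := n - 1 - W) (b := -(n * l)) (by linarith) (2 * 4 ^ n))
  obtain ⟨N, hN⟩ := eventually_atTop.mp (hev.and hW)
  refine Set.infinite_of_injective_forall_mem (α := ℕ)
    -- With `x₀ = q^n`, the error is `≪ q^n / q^{1+W} = x₀^{-(W-n+1)/n}`.
    (f := fun k (j : Fin (n + 1)) => q (k + N) ^ (n - (j : ℕ)) * p (k + N) ^ (j : ℕ)) ?_ ?_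
  · intro a b hab
    have h0 : q (a + N) ^ n = q (b + N) ^ n := by simpa using congrFun hab 0
    have h1 := (pow_left_inj₀ (h.den_pos _).le (h.den_pos _).le (by omega : n ≠ 0)).mp h0
    have := h.strictMono.injective h1
    omega
  · intro k
    obtain ⟨h1, h2⟩ := hN (k + N) (by omega)
    generalize k + N = k at *
    have hq := h.cast_pos k
    have hq1 := h.one_le_cast k
    have hq' := h.cast_pos (k + 1)
    refine ⟨by simpa using (pow_pos (h.den_pos k) n).ne', fun j _ => ?_⟩
    have hj : (j : ℕ) ≤ n := Nat.lt_succ_iff.mp j.2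
    have e1 : ((q k ^ (n - ((0 : Fin (n + 1)) : ℕ)) * p k ^ ((0 : Fin (n + 1)) : ℕ) : ℤ) : ℝ) =
        (q k : ℝ) ^ n := by simp
    have e2 : ((q k ^ (n - (j : ℕ)) * p k ^ (j : ℕ) : ℤ) : ℝ) =
        (q k : ℝ) ^ n * ((p k : ℝ) / q k) ^ (j : ℕ) := by
      push_cast
      rw [← pow_sub_mul_pow (q k : ℝ) hj, div_pow]
      field_simp
    rw [e1, e2, ← mul_sub, abs_mul, abs_of_pos (by positivity : 0 < (q k : ℝ) ^ n)]
    have e3 : |ξ ^ (j : ℕ) - ((p k : ℝ) / q k) ^ (j : ℕ)| ≤ 4 ^ n * (2 / (q k * (q k : ℝ) ^ W)) := by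
      refine (abs_pow_sub_pow_le (by linarith [h.abs_le_one])
        (by linarith [h.abs_div_le_one k]) _).trans ?_
      rw [abs_of_pos (h.sub_pos k)]
      gcongr
      · exact (h.sub_pos k).le
      · norm_num
      · refine (h.sub_le k).trans ?_
        gcongr
        exact (Real.rpow_le_rpow_of_exponent_le hq1 h2).trans (h.rpow_le k)
    calc _ ≤ (q k : ℝ) ^ n * (4 ^ n * (2 / (q k * (q k : ℝ) ^ W))) := by gcongr
      _ = 2 * 4 ^ n * (q k : ℝ) ^ ((n : ℝ) - 1 - W) := by
          rw [Real.rpow_sub hq, Real.rpow_sub hq, Real.rpow_one, Real.rpow_natCast]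
          field_simp
      _ ≤ _ := h1.le
      _ = _ := by
          rw [← Real.rpow_natCast, ← Real.rpow_mul hq.le]; ring_nf

end RapidApprox

/-- Integers that simultaneously approximate the powers of `ξ` very well come from a rational
approximation of `ξ`. -/
theorem exists_rat_of_simultaneous_approx {ξ δ : ℝ} (hξ : |ξ| ≤ 1) {n : ℕ} (hn : 1 ≤ n)
    {y : ℕ → ℤ} (hy0 : y 0 ≠ 0) (hδ : 0 ≤ δ) (hsmall : 4 * |(y 0 : ℝ)| * δ < 1)
    (hy : ∀ j, j ≤ n → |(y 0 : ℝ) * ξ ^ j - y j| ≤ δ) :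
    ∃ p q : ℤ, q ≠ 0 ∧ |(p : ℝ)| ≤ 2 * |(q : ℝ)| ∧ |(q : ℝ)| ^ n ≤ |(y 0 : ℝ)| ∧
      |(y 0 : ℝ)| * |q * ξ - p| ≤ |(q : ℝ)| * δ := by
  have hA : (1 : ℝ) ≤ |(y 0 : ℝ)| := by exact_mod_cast Int.one_le_abs hy0
  have hδ1 : δ ≤ 1 := by nlinarith
  have hg : 0 < Int.gcd (y 0) (y 1) := Int.gcd_pos_of_ne_zero_left _ hy0
  obtain ⟨q, p, hqp, hq, hp⟩ := Int.exists_gcd_one hg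
  set g : ℤ := (Int.gcd (y 0) (y 1) : ℤ) with hgdef
  have hg1 : 1 ≤ g := by rw [hgdef]; exact_mod_cast hg
  have hg1R : (1 : ℝ) ≤ g := by exact_mod_cast hg1
  have hq0 : q ≠ 0 := by rintro rfl; exact hy0 (by rw [hq, zero_mul])
  have hqR : (1 : ℝ) ≤ |(q : ℝ)| := by exact_mod_cast Int.one_le_abs hq0
  have hqy : (y 0 : ℝ) = q * g := by exact_mod_cast hq
  have hpy : (y 1 : ℝ) = p * g := by exact_mod_cast hp
  have hy1 := hy 1 hn
  rw [pow_one] at hy1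
  have hlin : |q * ξ - p| ≤ δ := by
    have e : (y 0 : ℝ) * ξ - y 1 = g * (q * ξ - p) := by rw [hqy, hpy]; ring
    rw [e, abs_mul, abs_of_pos (by linarith)] at hy1
    nlinarith [abs_nonneg ((q : ℝ) * ξ - p)]
  have hmul : |(y 0 : ℝ)| * |q * ξ - p| ≤ |(q : ℝ)| * δ := by
    have e : (y 0 : ℝ) * (q * ξ - p) = q * (y 0 * ξ - y 1) := by rw [hqy, hpy]; ring
    rw [← abs_mul, e, abs_mul]
    gcongr
  have hp2 : |(p : ℝ)| ≤ 2 * |(q : ℝ)| := by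
    have e : (p : ℝ) = q * ξ - (q * ξ - p) := by ring
    have h1 : |(q : ℝ)| * |ξ| ≤ |(q : ℝ)| * 1 := by gcongr
    calc |(p : ℝ)| = |(q : ℝ) * ξ - (q * ξ - p)| := by rw [← e]
      _ ≤ |(q : ℝ) * ξ| + |q * ξ - p| := abs_sub _ _
      _ ≤ _ := by rw [abs_mul]; linarith
  have hqA : |(q : ℝ)| ≤ |(y 0 : ℝ)| := by
    rw [hqy, abs_mul, abs_of_pos (by linarith : (0 : ℝ) < g)]
    nlinarith
  -- The integer `q y_{j+1} - p y_j` has absolute value at most `4 |y_0| δ < 1`, so it vanishes and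
  -- the `y_j` form a geometric progression of ratio `p/q`.
  have hstep : ∀ j, j + 1 ≤ n → q * y (j + 1) = p * y j := by
    intro j hj
    have e : ((q * y (j + 1) - p * y j : ℤ) : ℝ) = -(q * (y 0 * ξ ^ (j + 1) - y (j + 1))) +
        ξ ^ j * (y 0 * (q * ξ - p)) + p * (y 0 * ξ ^ j - y j) := by push_cast; ring
    have h1 : |((q * y (j + 1) - p * y j : ℤ) : ℝ)| < 1 := by
      calc _ ≤ |(q : ℝ)| * |y 0 * ξ ^ (j + 1) - y (j + 1)| +
            |ξ| ^ j * (|(y 0 : ℝ)| * |q * ξ - p|) + |(p : ℝ)| * |y 0 * ξ ^ j - y j| := by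
            rw [e]
            refine (abs_add_three _ _ _).trans (le_of_eq ?_)
            rw [abs_neg, abs_mul, abs_mul, abs_mul, abs_mul, abs_pow]
        _ ≤ |(q : ℝ)| * δ + 1 * (|(q : ℝ)| * δ) + 2 * |(q : ℝ)| * δ := by
            gcongr
            · exact hy _ hj
            · exact pow_le_one₀ (abs_nonneg _) hξ
            · exact hy _ (by omega)
        _ = 4 * |(q : ℝ)| * δ := by ring
        _ ≤ 4 * |(y 0 : ℝ)| * δ := by gcongr
        _ < 1 := hsmall
    have h2 : |q * y (j + 1) - p * y j| < 1 := by exact_mod_cast h1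
    exact sub_eq_zero.mp (Int.abs_lt_one_iff.mp h2)
  have hpow : ∀ j, j ≤ n → q ^ j * y j = p ^ j * y 0 := by
    intro j
    induction j with
    | zero => simp
    | succ j ih =>
      intro hj
      calc _ = q ^ j * (q * y (j + 1)) := by ring
        _ = p * (q ^ j * y j) := by rw [hstep j hj]; ring
        _ = _ := by rw [ih (by omega)]; ring
  have hdvd : q ^ n ∣ y 0 := by
    have h1 : q ^ n ∣ p ^ n * y 0 := ⟨y n, (hpow n le_rfl).symm⟩
    exact ((Int.isCoprime_iff_gcd_eq_one.mpr hqp).pow).dvd_of_dvd_mul_left h1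
  refine ⟨p, q, hq0, hp2, ?_, hmul⟩
  rw [← abs_pow]
  exact_mod_cast Int.le_of_dvd (abs_pos.mpr hy0) (abs_dvd_abs _ _ |>.mpr hdvd)

namespace RapidApprox

variable {ξ : ℝ} {p q : ℕ → ℤ} {w : ℕ → ℝ} {n : ℕ}

/-- A solution with large `A = |x₀|` comes from a fraction `r/s` with `|s|^n ≤ A`. The bound `|sξ -
r| ≫ |s|^{-W}` then gives `A^{l+1} ≪ |s|^{W+1} ≤ A^{(W+1)/n}`, impossible for large `A` if `l > (W -
n + 1)/n`. -/
theorem lambda_le {W : ℝ} (hn : 1 ≤ n) (hW : 2 * (n : ℝ) - 1 ≤ W)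
    (h : RapidApprox ξ p q fun _ => W) : lambda n ξ ≤ (((W - n + 1) / n : ℝ) : EReal) := by
  have hn1 : (1 : ℝ) ≤ n := by exact_mod_cast hn
  have hn0 : (0 : ℝ) < n := by linarith
  have hW0 : 0 < W := by linarith
  refine sSup_image_coe_le fun l hl => ?_
  by_contra! hlt
  rw [div_lt_iff₀ hn0] at hlt
  -- From `W ≥ 2n - 1`; it makes `A * A^{-l}` tend to 0, as the rigidity of the integer points
  -- requires.
  have hl1 : 1 < l := by nlinarith
  obtain ⟨c, hc, hcP⟩ := h.rpow_neg_le_abs_aeval hn hW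
  have hev1 := eventually_mul_rpow_lt_rpow (a := 1 - l) (b := 0) (by linarith) 4
  have hev2 := eventually_mul_rpow_lt_rpow (a := (W + 1) / n) (b := l + 1)
    (by rw [div_lt_iff₀ hn0]; linarith) (2 ^ W / c)
  obtain ⟨M, hM⟩ := eventually_atTop.mp (hev1.and hev2)
  refine hl ((Set.finite_Icc (fun _ : Fin (n + 1) => -(⌈M⌉ + 1)) fun _ => ⌈M⌉ + 1).subset ?_)
  rintro x ⟨hx0, hx⟩
  have hA : (1 : ℝ) ≤ |(x 0 : ℝ)| := by exact_mod_cast Int.one_le_abs hx0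
  have hA0 : (0 : ℝ) < |(x 0 : ℝ)| := by linarith
  set A := |(x 0 : ℝ)| with hAdef
  have hAM : A < M := by
    by_contra! hMA
    obtain ⟨h1, h2⟩ := hM A hMA
    rw [Real.rpow_zero] at h1
    let y : ℕ → ℤ := fun j => if hj : j < n + 1 then x ⟨j, hj⟩ else 0
    have hy0 : y 0 = x 0 := by simp [y]
    obtain ⟨r, s, hs0, hrs, hsA, hval⟩ := exists_rat_of_simultaneous_approx (ξ := ξ)
      (δ := A ^ (-l)) h.abs_le_one hn (y := y) (by rwa [hy0]) (by positivity) (by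
        rw [hy0]
        refine lt_of_eq_of_lt ?_ h1
        rw [sub_eq_add_neg, Real.rpow_add hA0, Real.rpow_one, mul_assoc]) (by
        intro j hj
        rw [hy0]
        rcases Nat.eq_zero_or_pos j with rfl | hj0
        · rw [hy0, pow_zero, mul_one, sub_self, abs_zero]; positivity
        · have e : y j = x ⟨j, by omega⟩ := dif_pos (by omega)
          rw [e]
          exact hx ⟨j, by omega⟩ hj0)
    rw [hy0] at hsA hval
    have hs1 : (1 : ℝ) ≤ |(s : ℝ)| := by exact_mod_cast Int.one_le_abs hs0
    have hlow := hcP (linPoly r s) (linPoly_ne_zero hs0) (by rwa [natDegree_linPoly hs0])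
    have hht : (polyHeight (linPoly r s) : ℝ) ≤ 2 * |(s : ℝ)| :=
      polyHeight_linPoly_le hrs (by linarith)
    have hht1 := one_le_polyHeight (linPoly_ne_zero (p := r) hs0)
    rw [aeval_linPoly] at hlow
    set σ := |(s : ℝ)|
    have hσ0 : 0 < σ := by linarith
    have e1 : c * (2 * σ) ^ (-W) ≤ |s * ξ - r| := by
      refine le_trans ?_ hlow
      gcongr ?_ * ?_
      exact Real.rpow_le_rpow_of_nonpos (by linarith) hht (by linarith)
    have e2 : A * (c * (2 * σ) ^ (-W)) ≤ σ * A ^ (-l) := by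
      refine le_trans ?_ hval
      gcongr
    have e3 : A ^ (l + 1) ≤ 2 ^ W / c * σ ^ (W + 1) := by
      rw [Real.rpow_neg (by positivity), Real.rpow_neg hA0.le, ← div_eq_mul_inv, ← div_eq_mul_inv,
        mul_div_assoc', div_le_div_iff₀ (by positivity) (by positivity),
        Real.mul_rpow (by norm_num) hσ0.le] at e2
      rw [Real.rpow_add hA0, Real.rpow_add hσ0, Real.rpow_one, Real.rpow_one, div_mul_eq_mul_div,
        le_div_iff₀ hc]
      linarith
    have e4 : σ ^ (W + 1) ≤ A ^ ((W + 1) / n) := by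
      have : σ ≤ A ^ (1 / (n : ℝ)) := by
        rw [← Real.rpow_natCast] at hsA
        calc σ = (σ ^ (n : ℝ)) ^ (1 / (n : ℝ)) := by
              rw [← Real.rpow_mul hσ0.le, mul_one_div_cancel hn0.ne', Real.rpow_one]
          _ ≤ _ := Real.rpow_le_rpow (by positivity) hsA (by positivity)
      calc _ ≤ (A ^ (1 / (n : ℝ))) ^ (W + 1) := Real.rpow_le_rpow hσ0.le this (by linarith)
        _ = _ := by rw [← Real.rpow_mul hA0.le]; ring_nf
    have e5 : 2 ^ W / c * σ ^ (W + 1) ≤ 2 ^ W / c * A ^ ((W + 1) / n) := by gcongr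
    linarith
  -- A bound on `x₀` confines the other coordinates, so only finitely many solutions remain.
  have hbound : ∀ j, |(x j : ℝ)| ≤ M + 1 := by
    intro j
    rcases Nat.eq_zero_or_pos (j : ℕ) with hj | hj
    · have : j = 0 := Fin.ext hj
      rw [this]; linarith
    · have h1 := hx j hj
      have h2 : A ^ (-l) ≤ 1 := Real.rpow_le_one_of_one_le_of_nonpos hA (by linarith)
      have h3 : |(x 0 : ℝ) * ξ ^ (j : ℕ)| ≤ A * 1 := by
        rw [abs_mul, abs_pow]
        gcongr
        exact pow_le_one₀ (abs_nonneg _) h.abs_le_one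
      have h4 := abs_sub_abs_le_abs_sub (x j : ℝ) ((x 0 : ℝ) * ξ ^ (j : ℕ))
      rw [abs_sub_comm] at h4
      linarith
  have hbound' : ∀ j, |x j| ≤ ⌈M⌉ + 1 := fun j => by
    have : ((|x j| : ℤ) : ℝ) ≤ ((⌈M⌉ + 1 : ℤ) : ℝ) := by
      push_cast
      linarith [hbound j, Int.le_ceil M]
    exact_mod_cast this
  exact ⟨fun j => (abs_le.mp (hbound' j)).1, fun j => (abs_le.mp (hbound' j)).2⟩

end RapidApprox

/-! ### The uniform exponent `ŵ_n` -/

theorem coeff_sum_monomial_fin {n : ℕ} (x : Fin (n + 1) → ℤ) (i : ℕ) :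
    (∑ j : Fin (n + 1), monomial (j : ℕ) (x j)).coeff i =
      if h : i < n + 1 then x ⟨i, h⟩ else 0 := by
  simp only [finsetSum_coeff, coeff_monomial]
  split_ifs with h
  · rw [Finset.sum_eq_single ⟨i, h⟩]
    · simp
    · exact fun j _ hj => if_neg fun h' => hj (Fin.ext h')
    · simp
  · exact Finset.sum_eq_zero fun j _ => if_neg fun h' => h (by have := j.2; omega)

/-- The derivative at `x` determines the linear coefficient from the higher ones, and the value at
`x` then determines the constant term. This makes the box principle's output a height bound. -/
theorem polyHeight_le_of_coeff_le {n : ℕ} (hn : 1 ≤ n) {P : ℤ[X]} (hP : P.natDegree ≤ n) {x Y : ℝ}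
    (hx : |x| ≤ 1) (hY : 1 ≤ Y) (hc : ∀ j, 2 ≤ j → |(P.coeff j : ℝ)| ≤ Y)
    (hv : |aeval x P| ≤ 1) :
    (polyHeight P : ℝ) ≤ |aeval x (derivative P)| + 2 * (n : ℝ) ^ 2 * Y := by
  obtain ⟨m, rfl⟩ : ∃ m, n = m + 1 := ⟨n - 1, by omega⟩
  have hxi : ∀ i : ℕ, |x| ^ i ≤ 1 := fun i => pow_le_one₀ (abs_nonneg _) hx
  have hder := aeval_derivative_eq_sum hP x
  have hval := aeval_eq_sum_range_succ hP x
  rw [Finset.sum_range_succ', Finset.sum_range_succ'] at hder hval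
  set D := aeval x (derivative P)
  set S := ∑ i ∈ Finset.range m, (P.coeff (i + 1 + 1) : ℝ) *
    ((i + 1 + 1 : ℕ) * x ^ (i + 1 + 1 - 1)) with hS
  set T := ∑ i ∈ Finset.range m, (P.coeff (i + 1 + 1) : ℝ) * x ^ (i + 1 + 1) with hT
  have hSle : |S| ≤ m * (Y * (m + 1)) := by
    refine (Finset.abs_sum_le_sum_abs _ _).trans
      ((Finset.sum_le_sum (g := fun _ => Y * ((m : ℝ) + 1)) fun i hi => ?_).trans (by simp))
    rw [abs_mul, abs_mul, abs_pow, Nat.abs_cast]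
    have hi' : ((i + 1 + 1 : ℕ) : ℝ) ≤ m + 1 := by
      have := Finset.mem_range.mp hi
      exact_mod_cast (by omega : i + 1 + 1 ≤ m + 1)
    calc _ ≤ Y * (((m : ℝ) + 1) * 1) := by
          gcongr
          · exact hc _ (by omega)
          · exact hxi _
      _ = _ := by ring
  have hTle : |T| ≤ m * Y := by
    refine (Finset.abs_sum_le_sum_abs _ _).trans
      ((Finset.sum_le_sum (g := fun _ => Y) fun i hi => ?_).trans (by simp))
    rw [abs_mul, abs_pow]
    calc _ ≤ Y * 1 := by
          gcongr
          · exact hc _ (by omega)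
          · exact hxi _
      _ = _ := mul_one _
  norm_num at hder hval
  have h1 : |(P.coeff 1 : ℝ)| ≤ |D| + m * (Y * (m + 1)) := by
    have e : (P.coeff 1 : ℝ) = D - S := by linarith
    rw [e]
    exact (abs_sub _ _).trans (by linarith)
  have h0 : |(P.coeff 0 : ℝ)| ≤ 1 + |D| + m * (Y * (m + 1)) + m * Y := by
    have e : (P.coeff 0 : ℝ) = aeval x P - T - P.coeff 1 * x := by linarith
    have h2 : |(P.coeff 1 : ℝ) * x| ≤ |(P.coeff 1 : ℝ)| * 1 := by
      rw [abs_mul]; gcongr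
    rw [e]
    refine (abs_sub _ _).trans ?_
    have := abs_sub (aeval x P) T
    linarith
  have hm : (0 : ℝ) ≤ m := m.cast_nonneg
  have hmY : 0 ≤ m * Y := by positivity
  have hmmY : 0 ≤ m * m * Y := by positivity
  push_cast
  refine polyHeight_le (by positivity) fun i => ?_
  rcases i with _ | _ | i
  · nlinarith
  · nlinarith [h1]
  · nlinarith [hc (i + 1 + 1) (by omega), abs_nonneg D]

theorem le_wHat {n : ℕ} (hn : 1 ≤ n) {ξ : ℝ} (hξ : |ξ| ≤ 1) (ht : Transcendental ℚ ξ) :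
    ((n : ℝ) : EReal) ≤ wHat n ξ := by
  refine coe_le_sSup_image_coe fun v hv => ?_
  set K : ℝ := 2 * (n : ℝ) ^ 2 + 2 with hK
  have hK0 : 0 < K := by positivity
  filter_upwards [eventually_mul_rpow_lt_rpow (a := -n) (b := -v) (by linarith) ((2 * K) ^ n),
    eventually_ge_atTop (2 * K)] with X hX1 hX2
  have hX0 : 0 < X := by linarith
  set Y := ⌊X / K⌋₊ with hY
  have hYle : (Y : ℝ) ≤ X / K := Nat.floor_le (by positivity)
  have hXK : 2 ≤ X / K := by rwa [le_div_iff₀ hK0]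
  have hYge : X / (2 * K) ≤ Y := by
    have := Nat.lt_floor_add_one (X / K)
    have e : X / (2 * K) = X / K / 2 := by field_simp
    rw [e]
    linarith
  have hY1R : (1 : ℝ) ≤ Y := by
    refine le_trans ?_ hYge
    rw [le_div_iff₀ (by positivity)]; linarith
  have hY1 : 1 ≤ Y := by exact_mod_cast hY1R
  obtain ⟨P, hP, hPn, hc, hd, hval⟩ := exists_small_value hn ξ hY1 hY1
  have hYn : (Y : ℝ) ^ (n - 1) * Y = Y ^ n := by
    rw [← pow_succ, Nat.sub_add_cancel hn]
  rw [hYn] at hval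
  have hval1 : |aeval ξ P| ≤ 1 := by
    refine hval.trans ?_
    rw [div_le_one (by positivity)]
    exact one_le_pow₀ hY1R
  have hH := polyHeight_le_of_coeff_le hn hPn hξ hY1R hc hval1
  have hHX : (polyHeight P : ℝ) ≤ X := by
    have h1 : (Y : ℝ) * K ≤ X := by rwa [le_div_iff₀ hK0] at hYle
    nlinarith
  have hsum : ∑ j : Fin (n + 1), (P.coeff j : ℝ) * ξ ^ (j : ℕ) = aeval ξ P := by
    rw [aeval_eq_sum_range_succ hPn, Finset.sum_range]
  refine ⟨fun j => P.coeff j, ?_, ?_, fun j => (abs_coeff_le_polyHeight P j).trans hHX⟩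
  · rw [hsum]
    exact abs_pos.mpr (aeval_ne_zero_of_transcendental ht hP)
  · rw [hsum]
    refine hval.trans (le_trans ?_ hX1.le)
    calc 1 / (Y : ℝ) ^ n ≤ 1 / (X / (2 * K)) ^ n := by gcongr
      _ = _ := by
          rw [Real.rpow_neg hX0.le, Real.rpow_natCast, div_pow]
          field_simp

namespace RapidApprox

variable {ξ : ℝ} {p q : ℕ → ℤ} {w : ℕ → ℝ} {n : ℕ}

theorem le_mul_polyHeight (h : RapidApprox ξ p q w) {P : ℤ[X]} (hP : P ≠ 0)
    (hPn : P.natDegree ≤ n) {k : ℕ} (hk : aeval ((p k : ℝ) / q k) P = 0) :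
    (q k : ℝ) ≤ (n + 1) * polyHeight P := by
  obtain ⟨R, rfl⟩ := exists_eq_linPoly_mul (h.coprime k) (h.den_pos k) hk
  have hR := right_ne_zero_of_mul hP
  have h1 := mul_polyHeight_le_of_linPoly_mul (h.abs_num_le k) (h.den_pos k) hR
  have h2 := one_le_polyHeight hR
  have hq := h.cast_pos k
  calc (q k : ℝ) ≤ q k * polyHeight R := le_mul_of_one_le_right hq.le h2
    _ ≤ _ := h1
    _ ≤ _ := by gcongr

/-- Tested at `X = q_k/K`: a nonzero polynomial of this height is too small to vanish at `p_k/q_k`,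
so its value at `ξ` is at least `1/(2 q_k^n)`, of order `X^{-n}`. -/
theorem wHat_le (h : RapidApprox ξ p q w) (hw : ∀ k, n ≤ w k) :
    wHat n ξ ≤ ((n : ℝ) : EReal) := by
  refine sSup_image_coe_le fun v hv => ?_
  by_contra! hlt
  have hT := one_le_taylorConst n
  set K : ℝ := 4 * taylorConst n * (n + 1) with hK
  have hn0 : (0 : ℝ) ≤ n := n.cast_nonneg
  have hK1 : n + 1 < K := by nlinarith
  have hK2 : 4 * taylorConst n ≤ K := by nlinarith
  have hK0 : 0 < K := by linarith
  have hlim : Tendsto (fun k => (q k : ℝ) / K) atTop atTop := h.tendsto.atTop_div_const hK0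
  obtain ⟨k, ⟨x, hx0, hxv, hxX⟩, hk⟩ := ((hlim.eventually hv).and (h.tendsto.eventually
    (eventually_mul_rpow_lt_rpow (a := -v) (b := -n) (by linarith) (2 * K ^ v)))).exists
  set P : ℤ[X] := ∑ j : Fin (n + 1), monomial (j : ℕ) (x j) with hPdef
  have hPn : P.natDegree ≤ n := natDegree_sum_le_of_forall_le _ _ fun j _ =>
    (natDegree_monomial_le _).trans (Nat.lt_succ_iff.mp j.2)
  have hq := h.cast_pos k
  have hsum : ∑ j : Fin (n + 1), (x j : ℝ) * ξ ^ (j : ℕ) = aeval ξ P := by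
    rw [aeval_eq_sum_range_succ hPn, Finset.sum_range]
    refine Finset.sum_congr rfl fun j _ => ?_
    rw [hPdef, coeff_sum_monomial_fin, dif_pos j.2]
  rw [hsum] at hx0 hxv
  have hP0 : P ≠ 0 := by
    intro h0
    rw [h0, map_zero, abs_zero] at hx0
    exact lt_irrefl _ hx0
  have hHX : (polyHeight P : ℝ) ≤ q k / K := by
    refine polyHeight_le (by positivity) fun i => ?_
    rw [hPdef, coeff_sum_monomial_fin]
    split_ifs with hi
    · exact hxX _
    · rw [Int.cast_zero, abs_zero]; positivity
  have hHK : polyHeight P * K ≤ q k := by rwa [le_div_iff₀ hK0] at hHX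
  have hH1 := one_le_polyHeight hP0
  have hroot : aeval ((p k : ℝ) / q k) P ≠ 0 := by
    intro h0
    have := h.le_mul_polyHeight hP0 hPn h0
    nlinarith
  have hlow := h.inv_le_abs_aeval hPn hroot (by
    have h1 := h.pow_le_next (hw k)
    gcongr
    nlinarith)
  have hup := hlow.trans hxv
  rw [Real.div_rpow hq.le hK0.le, Real.rpow_neg hK0.le, div_inv_eq_mul, mul_inv,
    ← Real.rpow_natCast, ← Real.rpow_neg hq.le] at hup
  linarith

/-! ### The uniform exponent `ŵ*_n` -/

/-- The upper bound for `ŵ*_n` only involves the growth of the denominators. -/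
theorem wHatStar_le (h : RapidApprox ξ p q w) (hn : 1 ≤ n) (hw : ∀ k, n ≤ w k) {W : ℝ}
    (hW : 2 * (n : ℝ) - 1 ≤ W) (hWw : ∀ᶠ k in atTop, W ≤ w k) :
    wHatStar n ξ ≤ ((W / (W - n + 1) : ℝ) : EReal) := by
  have hn1 : (1 : ℝ) ≤ n := by exact_mod_cast hn
  have hs0 : 0 < W - n + 1 := by linarith
  have hW0 : 0 < W := by linarith
  refine sSup_image_coe_le fun v hv => ?_
  by_contra! hlt
  have hv0 : 0 < v := (div_pos hW0 hs0).trans hlt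
  rw [div_lt_iff₀ hs0] at hlt
  have hT := one_le_taylorConst n
  set T := taylorConst n
  set K : ℝ := 4 * T with hK
  set L : ℝ := 2 * T + (n + 1) with hL
  have hK0 : 0 < K := by linarith
  have hL0 : 0 < L := by linarith
  -- The largest height to which the lower bound for nonvanishing at `p_k/q_k` applies; it serves as
  -- the critical value of `X`.
  let Z : ℕ → ℝ := fun k => q k * q (k + 1) / (K * (q k : ℝ) ^ n)
  have hZ : Tendsto Z atTop atTop := by
    refine tendsto_atTop_mono (fun k => ?_) (h.tendsto.atTop_div_const hK0)
    have hq := h.cast_pos k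
    have h1 := h.pow_le_next (hw k)
    rw [div_le_div_iff₀ hK0 (by positivity)]
    calc (q k : ℝ) * (K * (q k : ℝ) ^ n) = q k * (q k : ℝ) ^ n * K := by ring
      _ ≤ _ := by gcongr
  have hq1lim : Tendsto (fun k => (q (k + 1) : ℝ)) atTop atTop :=
    h.tendsto.comp (tendsto_add_atTop_nat 1)
  obtain ⟨k, ⟨⟨⟨α, hα, hαn, hα0, hαv, hαX⟩, hZ1⟩, hWk⟩, hk⟩ := (((hZ.eventually hv).and
    (hZ.eventually_ge_atTop 1)).and hWw).and (hq1lim.eventually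
      (eventually_mul_rpow_lt_rpow (a := W) (b := v * (W - n + 1)) hlt (K ^ (W * v) * L ^ W)))
    |>.exists
  have hq := h.cast_pos k
  have hq1 := h.one_le_cast k
  have hq' := h.cast_pos (k + 1)
  have hZ0 : 0 < Z k := by linarith
  have hA := one_le_algHeight α
  have hA0 : (0 : ℝ) < algHeight α := by linarith
  have hZv : 0 < Z k ^ v := by positivity
  rw [Real.rpow_neg hZ0.le] at hαv
  have hPn : (intMinpoly α).natDegree ≤ n := by rwa [natDegree_intMinpoly hα]
  -- If `α = p_k/q_k`, the bound comes from `ξ - p_k/q_k ≥ 1/(q_k q_{k+1})` and `q_k ≤ (n + 1)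
  -- H(α)`. Otherwise the minimal polynomial is at least `1/(2 q_k^n)` at `ξ`, which keeps its root
  -- `α` away, and `q_k^n ≤ q_{k+1}`.
  have hmain : Z k ^ v ≤ L * q (k + 1) := by
    by_cases hroot : aeval ((p k : ℝ) / q k) (intMinpoly α) = 0
    · have hαu : α = (p k : ℝ) / q k := by
        have := eq_of_aeval_intMinpoly hα (r := (p k : ℚ) / q k) (by push_cast; exact hroot)
        rw [this]; push_cast; rfl
      have h1 := h.le_mul_polyHeight (intMinpoly_ne_zero α) hPn hroot
      change (q k : ℝ) ≤ (n + 1) * algHeight α at h1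
      have h2 : 1 / ((q k : ℝ) * q (k + 1)) ≤ (algHeight α : ℝ)⁻¹ * (Z k ^ v)⁻¹ := by
        refine (h.le_sub k).trans (le_trans ?_ hαv)
        rw [hαu]
        exact le_abs_self _
      rw [← mul_inv, ← one_div, div_le_div_iff₀ (by positivity) (by positivity), one_mul,
        one_mul] at h2
      have h3 : (algHeight α : ℝ) * Z k ^ v ≤ algHeight α * ((n + 1) * q (k + 1)) := by
        refine h2.trans ?_
        calc _ ≤ (n + 1) * (algHeight α : ℝ) * q (k + 1) := by gcongr
          _ = _ := by ring
      have h4 := le_of_mul_le_mul_left h3 hA0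
      nlinarith
    · have hα2 : |α| ≤ 2 := by
        have h1 : (algHeight α : ℝ)⁻¹ * (Z k ^ v)⁻¹ ≤ 1 * 1 := by
          gcongr
          · exact inv_le_one_of_one_le₀ hA
          · exact inv_le_one_of_one_le₀ (Real.one_le_rpow hZ1 hv0.le)
        have h2 := abs_sub_abs_le_abs_sub α ξ
        rw [abs_sub_comm] at h2
        linarith [h.abs_le_one]
      have hlow := h.inv_le_abs_aeval hPn hroot (by
        rw [le_div_iff₀ (by positivity)] at hαX
        change 4 * T * (algHeight α : ℝ) * _ ≤ _
        linarith)
      have h2 := abs_aeval_sub_aeval_le hPn (x := ξ) (y := α) (by linarith [h.abs_le_one]) hα2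
      rw [aeval_intMinpoly hα, sub_zero] at h2
      have h3 : (2 * (q k : ℝ) ^ n)⁻¹ ≤ T * (Z k ^ v)⁻¹ := by
        refine hlow.trans (h2.trans ?_)
        change T * (algHeight α : ℝ) * |ξ - α| ≤ _
        calc _ ≤ T * (algHeight α : ℝ) * ((algHeight α : ℝ)⁻¹ * (Z k ^ v)⁻¹) := by gcongr
          _ = _ := by field_simp
      rw [inv_eq_one_div, ← div_eq_mul_inv, div_le_div_iff₀ (by positivity) hZv, one_mul] at h3
      have h4 : T * (2 * (q k : ℝ) ^ n) ≤ T * (2 * q (k + 1)) := by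
        gcongr; exact h.pow_le_next (hw k)
      nlinarith
  -- Eliminating `q_k` from `q_{k+1} = K Z q_k^{n-1}` bounds `q_{k+1}^{W-n+1}` by `(K Z)^W`. Raising
  -- this to the power `v` and using `hmain` contradicts `v (W - n + 1) > W` for large `k`.
  have hxW : (q k : ℝ) ^ W ≤ q (k + 1) :=
    (Real.rpow_le_rpow_of_exponent_le hq1 hWk).trans (h.rpow_le k)
  have e1 : (q (k + 1) : ℝ) ^ (W - n + 1) ≤ K ^ W * Z k ^ W := by
    have hZe : K * Z k * (q k : ℝ) ^ (n - 1) = q (k + 1) := by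
      have : (q k : ℝ) ^ n = (q k : ℝ) ^ (n - 1) * q k := by
        rw [← pow_succ, Nat.sub_add_cancel hn]
      simp only [Z]
      rw [this]
      field_simp
    have e2 : (q (k + 1) : ℝ) ^ W ≤ K ^ W * Z k ^ W * (q (k + 1) : ℝ) ^ (n - 1) := by
      calc (q (k + 1) : ℝ) ^ W = (K * Z k * (q k : ℝ) ^ (n - 1)) ^ W := by rw [hZe]
        _ = K ^ W * Z k ^ W * ((q k : ℝ) ^ W) ^ (n - 1) := by
            rw [Real.mul_rpow (by positivity) (by positivity),
              Real.mul_rpow (by positivity) (by positivity), ← Real.rpow_natCast,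
              ← Real.rpow_natCast, ← Real.rpow_mul hq.le, ← Real.rpow_mul hq.le,
              mul_comm W]
        _ ≤ _ := by gcongr
    have e3 : (q (k + 1) : ℝ) ^ (W - n + 1) * (q (k + 1) : ℝ) ^ (n - 1) =
        (q (k + 1) : ℝ) ^ W := by
      rw [← Real.rpow_natCast, ← Real.rpow_add hq', Nat.cast_sub hn]
      push_cast
      ring_nf
    rw [← e3] at e2
    exact le_of_mul_le_mul_right e2 (by positivity)
  have e4 : (q (k + 1) : ℝ) ^ (v * (W - n + 1)) ≤ K ^ (W * v) * L ^ W * (q (k + 1) : ℝ) ^ W := by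
    calc _ = ((q (k + 1) : ℝ) ^ (W - n + 1)) ^ v := by rw [← Real.rpow_mul hq'.le, mul_comm]
      _ ≤ (K ^ W * Z k ^ W) ^ v := Real.rpow_le_rpow (by positivity) e1 hv0.le
      _ = K ^ (W * v) * (Z k ^ v) ^ W := by
          rw [Real.mul_rpow (by positivity) (by positivity), ← Real.rpow_mul hK0.le,
            ← Real.rpow_mul hZ0.le, ← Real.rpow_mul hZ0.le, mul_comm v]
      _ ≤ K ^ (W * v) * (L * q (k + 1)) ^ W := by gcongr
      _ = _ := by rw [Real.mul_rpow hL0.le hq'.le]; ring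
  linarith

/-- The fractions `p_k/q_k` alone suffice, taking `k` with `D q_k ≤ X < D q_{k+1}`. -/
theorem one_le_wHatStar (h : RapidApprox ξ p q w) (hn : 1 ≤ n) :
    ((1 : ℝ) : EReal) ≤ wHatStar n ξ := by
  refine coe_le_sSup_image_coe fun v hv => ?_
  have hD := one_le_divisorConst n
  set D := divisorConst n with hDdef
  filter_upwards [eventually_mul_rpow_lt_rpow (a := -1) (b := -v) (by linarith) (2 * D ^ 2),
    eventually_ge_atTop (D * q 0)] with X hX1 hX2
  have hX0 : 0 < X := lt_of_lt_of_le (mul_pos (by linarith) (h.cast_pos 0)) hX2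
  have hex : ∃ k, X < D * q k := by
    obtain ⟨k, hk⟩ := (h.tendsto.eventually_gt_atTop X).exists
    exact ⟨k, hk.trans_le (le_mul_of_one_le_left (h.cast_pos k).le hD)⟩
  classical
  have hspec := Nat.find_spec hex
  have hmin := fun j => Nat.find_min (H := hex) (m := j)
  generalize Nat.find hex = k at hspec hmin
  rcases k with _ | k
  · exact absurd hspec (not_lt.mpr hX2)
  have hk := not_lt.mp (hmin k (Nat.lt_succ_self k))
  have hq := h.cast_pos k
  have hq' := h.cast_pos (k + 1)
  have hL0 := linPoly_ne_zero (p := p k) (h.den_pos k).ne'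
  have hL1 := natDegree_linPoly (p := p k) (h.den_pos k).ne'
  have hroot : aeval ((p k : ℝ) / q k) (linPoly (p k) (q k)) = 0 := by
    rw [aeval_linPoly]; field_simp; ring
  have hH : (algHeight ((p k : ℝ) / q k) : ℝ) ≤ D * q k := by
    refine (algHeight_le (n := n) hL0 (by rw [hL1]; exact hn) hroot).trans ?_
    gcongr
    exact polyHeight_linPoly_le (h.abs_num_le k) (by rw [abs_of_pos hq])
  have hH1 := one_le_algHeight ((p k : ℝ) / q k)
  refine ⟨(p k : ℝ) / q k, isAlgebraic_of_aeval_int hL0 hroot,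
    (natDegree_minpoly_le hL0 hroot).trans (by rw [hL1]; exact hn),
    abs_pos.mpr (h.sub_pos k).ne', ?_, hH.trans hk⟩
  rw [abs_of_pos (h.sub_pos k)]
  have hD0 : 0 < D := by linarith
  calc _ ≤ 2 / ((q k : ℝ) * q (k + 1)) := h.sub_le k
    _ = 2 * D ^ 2 * ((D * q k)⁻¹ * (D * q (k + 1))⁻¹) := by field_simp
    _ ≤ 2 * D ^ 2 * ((algHeight ((p k : ℝ) / q k) : ℝ)⁻¹ * X⁻¹) := by gcongr
    _ = (algHeight ((p k : ℝ) / q k) : ℝ)⁻¹ * (2 * D ^ 2 * X ^ (-1 : ℝ)) := by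
        rw [Real.rpow_neg_one]; ring
    _ ≤ _ := by gcongr

/-- The box principle is used with unequal sizes: `Y` for the coefficients of index at least 2 and
about `M Y^{W-n+1}` for the derivative, so the value at `ξ` is below `1/(M Y^W)`. This is too small
for a polynomial of height `≪ Y`, so the height comes mostly from the derivative. -/
theorem exists_algebraic_approx {W : ℝ} (hn : 1 ≤ n) (hW : 2 * (n : ℝ) - 1 ≤ W)
    (h : RapidApprox ξ p q fun _ => W) :
    ∃ C : ℝ, 1 ≤ C ∧ ∀ Y : ℕ, 1 ≤ Y → ∃ α : ℝ, IsAlgebraic ℚ α ∧ (minpoly ℚ α).natDegree ≤ n ∧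
      |ξ - α| ≤ (algHeight α : ℝ)⁻¹ * (C * (Y : ℝ) ^ (-W)) ∧
      (algHeight α : ℝ) ≤ C * (Y : ℝ) ^ (W - n + 1) := by
  have hn1 : (1 : ℝ) ≤ n := by exact_mod_cast hn
  have hW0 : 0 < W := by linarith
  obtain ⟨c₀, hc₀, hcP₀⟩ := h.rpow_neg_le_abs_aeval hn hW
  have hT := one_le_taylorConst n
  have hD := one_le_divisorConst n
  set T := taylorConst n
  set D := divisorConst n
  obtain ⟨c, hc, hcT, hcc⟩ : ∃ c : ℝ, 0 < c ∧ c ≤ 1 / (16 * T) ∧ c ≤ c₀ :=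
    ⟨min (1 / (16 * T)) c₀, by positivity, min_le_left _ _, min_le_right _ _⟩
  have hcP : ∀ P : ℤ[X], P ≠ 0 → P.natDegree ≤ n → c * (polyHeight P : ℝ) ^ (-W) ≤ |aeval ξ P| :=
    fun P hP hPn => le_trans (by gcongr) (hcP₀ P hP hPn)
  set K : ℝ := 2 * (n : ℝ) ^ 2 with hK
  have hK1 : 1 ≤ K := by nlinarith
  -- Chosen so that `c (2KY)^{-W} = 1/(M Y^W)`: a height at most `2KY` would contradict the lower
  -- bound at `ξ`.
  set M : ℝ := (2 * K) ^ W / c with hM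
  have hM0 : 0 < M := by positivity
  have hMc : 1 / M ≤ c := by
    rw [hM, one_div_div]
    exact div_le_self hc.le (Real.one_le_rpow (by linarith) hW0.le)
  refine ⟨4 * D / M + D * (M + 3 + K), ?_, fun Y hY => ?_⟩
  · have : 0 < 4 * D / M := by positivity
    nlinarith
  have hYR : (1 : ℝ) ≤ Y := by exact_mod_cast hY
  have hY0 : (0 : ℝ) < Y := by linarith
  set B : ℕ := ⌊M * (Y : ℝ) ^ (W - n + 1)⌋₊ + 1 with hB
  have hs0 : 0 < (Y : ℝ) ^ (W - n + 1) := by positivity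
  have hYs : (Y : ℝ) ≤ (Y : ℝ) ^ (W - n + 1) := by
    conv_lhs => rw [← Real.rpow_one (Y : ℝ)]
    exact Real.rpow_le_rpow_of_exponent_le hYR (by linarith)
  have hB1 : M * (Y : ℝ) ^ (W - n + 1) < B := by
    rw [hB]; push_cast; exact Nat.lt_floor_add_one _
  have hB2 : (B : ℝ) ≤ M * (Y : ℝ) ^ (W - n + 1) + 1 := by
    rw [hB]; push_cast
    linarith [Nat.floor_le (mul_pos hM0 hs0).le]
  obtain ⟨P, hP, hPn, hcoef, hd, hval⟩ := exists_small_value hn ξ hY (B := B) (by omega)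
  have hval' : |aeval ξ P| < 1 / (M * (Y : ℝ) ^ W) := by
    refine lt_of_le_of_lt hval ?_
    have e : (Y : ℝ) ^ (n - 1) * (M * (Y : ℝ) ^ (W - n + 1)) = M * (Y : ℝ) ^ W := by
      rw [mul_left_comm, ← Real.rpow_natCast, ← Real.rpow_add hY0, Nat.cast_sub hn]
      push_cast
      ring_nf
    rw [← e]
    gcongr
  have hval1 : |aeval ξ P| ≤ 1 / (16 * T) := by
    refine hval'.le.trans (le_trans ?_ (hMc.trans hcT))
    gcongr
    exact le_mul_of_one_le_right hM0.le (Real.one_le_rpow hYR hW0.le)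
  have hval2 : 16 * T * |aeval ξ P| ≤ 1 := by
    rw [le_div_iff₀ (by positivity)] at hval1
    linarith
  have hH1 := one_le_polyHeight hP
  have hlarge : 2 * K * Y < polyHeight P := by
    by_contra! hle
    have h1 : c * (2 * K * Y) ^ (-W) ≤ |aeval ξ P| := by
      refine le_trans ?_ (hcP P hP hPn)
      gcongr ?_ * ?_
      exact Real.rpow_le_rpow_of_nonpos (by linarith) hle (by linarith)
    have e : c * (2 * K * Y : ℝ) ^ (-W) = 1 / (M * (Y : ℝ) ^ W) := by
      rw [hM, Real.rpow_neg (by positivity), Real.mul_rpow (by positivity) hY0.le]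
      field_simp
    linarith
  have hHd := polyHeight_le_of_coeff_le hn hPn h.abs_le_one hYR hcoef
    (by nlinarith [abs_nonneg (aeval ξ P)])
  obtain ⟨α, hα, hdist⟩ := exists_root_near hPn hP h.abs_le_one (by linarith) hval2
  have hαH := algHeight_le hP hPn hα
  have hA := one_le_algHeight α
  refine ⟨α, isAlgebraic_of_aeval_int hP hα, (natDegree_minpoly_le hP hα).trans hPn, ?_, ?_⟩
  · have hinv : (polyHeight P : ℝ)⁻¹ ≤ D * (algHeight α : ℝ)⁻¹ := by
      rw [← div_eq_mul_inv, inv_eq_one_div, div_le_div_iff₀ (by linarith) (by linarith)]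
      linarith
    calc |ξ - α| ≤ 4 * |aeval ξ P| / polyHeight P := hdist
      _ = 4 * |aeval ξ P| * (polyHeight P : ℝ)⁻¹ := div_eq_mul_inv _ _
      _ ≤ 4 * (1 / (M * (Y : ℝ) ^ W)) * (D * (algHeight α : ℝ)⁻¹) := by gcongr
      _ = (algHeight α : ℝ)⁻¹ * (4 * D / M * (Y : ℝ) ^ (-W)) := by
          rw [Real.rpow_neg hY0.le]; field_simp
      _ ≤ _ := by
          gcongr
          have : 0 ≤ D * (M + 3 + K) := by positivity
          linarith
  · have h1 : (1 : ℝ) ≤ (Y : ℝ) ^ (W - n + 1) := hYR.trans hYs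
    have h2 : K * Y ≤ K * (Y : ℝ) ^ (W - n + 1) := by gcongr
    calc (algHeight α : ℝ) ≤ D * polyHeight P := hαH
      _ ≤ D * ((M + 3 + K) * (Y : ℝ) ^ (W - n + 1)) := by
          gcongr
          nlinarith
      _ = D * (M + 3 + K) * (Y : ℝ) ^ (W - n + 1) := by ring
      _ ≤ _ := by
          gcongr
          have : 0 ≤ 4 * D / M := by positivity
          linarith

theorem le_wHatStar {W : ℝ} (hn : 1 ≤ n) (hW : 2 * (n : ℝ) - 1 ≤ W)
    (h : RapidApprox ξ p q fun _ => W) (ht : Transcendental ℚ ξ) :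
    ((W / (W - n + 1) : ℝ) : EReal) ≤ wHatStar n ξ := by
  have hn1 : (1 : ℝ) ≤ n := by exact_mod_cast hn
  have hW0 : 0 < W := by linarith
  obtain ⟨C, hC, hα⟩ := h.exists_algebraic_approx hn hW
  set s := W - n + 1 with hs
  have hs0 : 0 < s := by linarith
  refine coe_le_sSup_image_coe fun v hv => ?_
  filter_upwards [eventually_mul_rpow_lt_rpow (a := -(W / s)) (b := -v) (by linarith)
    (C * (2 ^ W * C ^ (W / s))), eventually_ge_atTop (C * 2 ^ s)] with X hX1 hX2
  have hC0 : 0 < C := by linarith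
  have hX0 : 0 < X := lt_of_lt_of_le (by positivity) hX2
  -- The solution of `C t^s = X`; its integer part is the `Y` used, losing at most a factor 2.
  set t := (X / C) ^ (1 / s) with ht'
  have ht2 : 2 ≤ t := by
    have h1 : (2 : ℝ) ^ s ≤ X / C := by rw [le_div_iff₀ hC0]; linarith
    calc (2 : ℝ) = (2 ^ s) ^ (1 / s) := by
          rw [← Real.rpow_mul (by norm_num), mul_one_div_cancel hs0.ne', Real.rpow_one]
      _ ≤ t := Real.rpow_le_rpow (by positivity) h1 (by positivity)
  have ht0 : 0 < t := by linarith
  have hts : t ^ s = X / C := by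
    rw [ht', ← Real.rpow_mul (by positivity), one_div_mul_cancel hs0.ne', Real.rpow_one]
  have hYle : (⌊t⌋₊ : ℝ) ≤ t := Nat.floor_le ht0.le
  have hYge : t / 2 ≤ (⌊t⌋₊ : ℝ) := by linarith [Nat.lt_floor_add_one t]
  obtain ⟨α, hαalg, hαn, hdist, hH⟩ := hα ⌊t⌋₊ (Nat.le_floor (by push_cast; linarith))
  refine ⟨α, hαalg, hαn, abs_pos.mpr (sub_ne_zero.mpr ?_), hdist.trans ?_, hH.trans ?_⟩
  · rintro rfl
    exact ht hαalg
  · gcongr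
    refine le_trans ?_ hX1.le
    have h1 : (⌊t⌋₊ : ℝ) ^ (-W) ≤ (t / 2) ^ (-W) :=
      Real.rpow_le_rpow_of_nonpos (by positivity) hYge (by linarith)
    have h2 : (t / 2) ^ (-W) = 2 ^ W * C ^ (W / s) * X ^ (-(W / s)) := by
      have e : t ^ (-W) = (X / C) ^ (-(W / s)) := by
        rw [ht', ← Real.rpow_mul (by positivity)]; ring_nf
      rw [Real.div_rpow ht0.le (by norm_num), e, Real.div_rpow hX0.le hC0.le,
        Real.rpow_neg (by norm_num : (0 : ℝ) ≤ 2), Real.rpow_neg hC0.le, div_inv_eq_mul,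
        div_inv_eq_mul]
      ring
    rw [h2] at h1
    calc _ ≤ C * (2 ^ W * C ^ (W / s) * X ^ (-(W / s))) := by gcongr
      _ = _ := by ring
  · calc C * (⌊t⌋₊ : ℝ) ^ s ≤ C * t ^ s := by gcongr
      _ = X := by rw [hts]; field_simp

end RapidApprox

/-! ### Values of the exponents -/

theorem exists_lambda_eq {n : ℕ} (hn : 1 ≤ n) {t : EReal} (ht : 1 ≤ t) :
    ∃ ξ : ℝ, Transcendental ℚ ξ ∧ lambda n ξ = t := by
  have hn1 : (1 : ℝ) ≤ n := by exact_mod_cast hn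
  have hn0 : (n : ℝ) ≠ 0 := by positivity
  induction t using EReal.rec with
  | bot => exact absurd (le_bot_iff.mp ht) (EReal.coe_ne_bot 1)
  | top =>
    obtain ⟨ξ, hξ, p, q, h⟩ := exists_transcendental_rapidApprox (w := fun k => max 1 (k : ℝ))
      fun k => le_max_left _ _
    refine ⟨ξ, hξ, EReal.eq_top_iff_forall_lt _ |>.mpr fun y => ?_⟩
    have hW : ∀ᶠ k : ℕ in atTop, (n : ℝ) * (y + 1) + n - 1 ≤ max 1 (k : ℝ) :=
      (tendsto_natCast_atTop_atTop.eventually_ge_atTop _).mono fun k hk =>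
        hk.trans (le_max_right _ _)
    refine lt_of_lt_of_le ?_ (h.le_lambda hn hW)
    rw [EReal.coe_lt_coe_iff, lt_div_iff₀ (by positivity)]
    linarith
  | coe t =>
    have ht1 : 1 ≤ t := by exact_mod_cast ht
    have hW : 2 * (n : ℝ) - 1 ≤ n * t + n - 1 := by nlinarith
    obtain ⟨ξ, hξ, p, q, h⟩ := exists_transcendental_rapidApprox
      (w := fun _ => (n : ℝ) * t + n - 1) fun k => by linarith
    have e : (((n : ℝ) * t + n - 1) - n + 1) / n = t := by field_simp; ring
    have h1 := h.lambda_le hn hW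
    have h2 := h.le_lambda hn (.of_forall fun _ => le_rfl)
    rw [e] at h1 h2
    exact ⟨ξ, hξ, le_antisymm h1 h2⟩

theorem exists_wHat_eq_and_wHatStar_eq {n : ℕ} (hn : 1 ≤ n) {t : ℝ} (ht1 : 1 ≤ t)
    (ht2 : t ≤ 2 - 1 / (n : ℝ)) :
    ∃ ξ : ℝ, Transcendental ℚ ξ ∧ wHat n ξ = (n : ℝ) ∧ wHatStar n ξ = (t : ℝ) := by
  have hn1 : (1 : ℝ) ≤ n := by exact_mod_cast hn
  have hn0 : (0 : ℝ) < n := by linarith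
  rcases ht1.eq_or_lt with rfl | ht1
  · obtain ⟨ξ, hξ, p, q, h⟩ := exists_transcendental_rapidApprox
      (w := fun k => max (n : ℝ) k) fun k => hn1.trans (le_max_left _ _)
    have hw : ∀ k : ℕ, (n : ℝ) ≤ max (n : ℝ) k := fun k => le_max_left _ _
    refine ⟨ξ, hξ, le_antisymm (h.wHat_le hw) (le_wHat hn h.abs_le_one hξ),
      le_antisymm ?_ (h.one_le_wHatStar hn)⟩
    refine EReal.le_of_forall_lt_iff_le.mp fun z hz => ?_
    have hz1 : 0 < z - 1 := by
      rw [EReal.coe_lt_coe_iff] at hz; linarith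
    -- The second inequality is `W/(W - n + 1) ≤ z` rearranged; the growth exponents eventually
    -- exceed any such `W`.
    obtain ⟨W, hW1, hW2⟩ : ∃ W : ℝ, 2 * (n : ℝ) - 1 ≤ W ∧ z * (n - 1) / (z - 1) ≤ W :=
      ⟨_, le_max_left _ _, le_max_right _ _⟩
    refine (h.wHatStar_le hn hw hW1 ((tendsto_natCast_atTop_atTop.eventually_ge_atTop W).mono
      fun k hk => hk.trans (le_max_right _ _))).trans ?_
    rw [EReal.coe_le_coe_iff, div_le_iff₀ (by linarith)]
    rw [div_le_iff₀ hz1] at hW2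
    linarith
  · have ht0 : 0 < t - 1 := by linarith
    have htn : n * t ≤ 2 * n - 1 := by
      have := mul_le_mul_of_nonneg_left ht2 hn0.le
      rw [mul_sub, mul_one_div_cancel hn0.ne'] at this
      linarith
    have hn2 : (n : ℝ) - 1 ≠ 0 := by
      intro h0
      have : (n : ℝ) = 1 := by linarith
      rw [this] at htn
      linarith
    have hW : 2 * (n : ℝ) - 1 ≤ t * (n - 1) / (t - 1) := by
      rw [le_div_iff₀ ht0]; nlinarith
    -- The exponent is the solution `W` of `W/(W - n + 1) = t`; the bound `t ≤ 2 - 1/n` is what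
    -- makes it at least `2n - 1`.
    obtain ⟨ξ, hξ, p, q, h⟩ := exists_transcendental_rapidApprox
      (w := fun _ => t * ((n : ℝ) - 1) / (t - 1)) fun k => by linarith
    have e : t * ((n : ℝ) - 1) / (t - 1) / (t * (n - 1) / (t - 1) - n + 1) = t := by
      have e1 : t * ((n : ℝ) - 1) / (t - 1) - n + 1 = (n - 1) / (t - 1) := by
        field_simp; ring
      rw [e1]
      field_simp
    have hw : (n : ℝ) ≤ t * (n - 1) / (t - 1) := by linarith
    have h1 := h.wHatStar_le hn (fun _ => hw) hW (.of_forall fun _ => le_rfl)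
    have h2 := h.le_wHatStar hn hW hξ
    rw [e] at h1 h2
    exact ⟨ξ, hξ, le_antisymm (h.wHat_le fun _ => hw) (le_wHat hn h.abs_le_one hξ),
      le_antisymm h1 h2⟩

theorem exists_coe_of_mem_Icc {a b : ℝ} {t : EReal} (ht : t ∈ Set.Icc (a : EReal) b) :
    ∃ s : ℝ, t = s ∧ a ≤ s ∧ s ≤ b := by
  have hbot : t ≠ ⊥ := ((EReal.bot_lt_coe a).trans_le ht.1).ne'
  have htop : t ≠ ⊤ := (ht.2.trans_lt (EReal.coe_lt_top b)).ne
  lift t to ℝ using ⟨htop, hbot⟩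
  exact ⟨t, rfl, EReal.coe_le_coe_iff.mp ht.1, EReal.coe_le_coe_iff.mp ht.2⟩

end DiophantineExponent

theorem theorem5p6 (n : ℕ) (hn : 1 ≤ n) :
    Set.Icc (1 : EReal) ⊤ ⊆
        DiophantineExponent.exponentSpectrum (DiophantineExponent.lambda n) ∧
    Set.Icc (1 : EReal) ((2 - 1 / (n : ℝ) : ℝ) : EReal) ⊆
        DiophantineExponent.exponentSpectrum (DiophantineExponent.wHatStar n) ∧
    Set.Icc (((n : ℝ) - 2 + 1 / (n : ℝ) : ℝ) : EReal) (((n : ℝ) - 1 : ℝ) : EReal) ⊆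
        DiophantineExponent.exponentSpectrum
          (fun ξ => DiophantineExponent.wHat n ξ - DiophantineExponent.wHatStar n ξ) := by
  refine ⟨fun t ht => ?_, fun t ht => ?_, fun t ht => ?_⟩
  · exact DiophantineExponent.exists_lambda_eq hn ht.1
  · obtain ⟨s, rfl, h1, h2⟩ := DiophantineExponent.exists_coe_of_mem_Icc (a := 1) ht
    obtain ⟨ξ, hξ, -, h⟩ := DiophantineExponent.exists_wHat_eq_and_wHatStar_eq hn h1 h2
    exact ⟨ξ, hξ, h⟩
  · obtain ⟨s, rfl, h1, h2⟩ := DiophantineExponent.exists_coe_of_mem_Icc ht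
    -- Since `ŵ_n = n` throughout the family, the third interval is the image of the second under `t
    -- ↦ n - t`.
    obtain ⟨ξ, hξ, h, h'⟩ := DiophantineExponent.exists_wHat_eq_and_wHatStar_eq hn
      (t := n - s) (by linarith) (by linarith)
    refine ⟨ξ, hξ, ?_⟩
    simp only [h, h']
    rw [← EReal.coe_sub, sub_sub_cancel]
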